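/- **Setting.** Let $K$ be a field, $Q$ a finite quiver, $\mathcal B$ the set of its finite directed paths (vertices are the paths of length $0$), $\ell(p)$ the length of a path $p$, and $J\subseteq KQ$ the two-sided ideal generated by the arrows. A path $p$ is a subpath of $q$ if $q=rps$ for some paths $r,s$. Fix an admissible order $\succ$ on $\mathcal B$: a well-order such that $p\succ q$ implies $pr\succ qr$ and $sp\succ sq$ whenever both products are nonzero, and $p\succeq q$ whenever $q$ is a subpath of $p$. For a commutative ring $R$ and $0\ne x\in RQ$, $\operatorname{tip}(x)$ is the $\succ$-largest path occurring in $x$; $\operatorname{tip}(X)=\{\operatorname{tip}(x)\mid 0\neq x\in X\}$. *Reduced Gröbner basis.* For an ideal $I$ of $KQ$ let $\mathcal T_I$ be the unique minimal set of paths that generates the ideal $\langle\operatorname{tip}(I)\rangle$. For $t\in\mathcal T_I$ let $g_t$ be the unique element of $I$ such that $t-g_t$ is a linear combination of paths not in $\operatorname{tip}(I)$. The set $\{g_t\mid t\in\mathcal T_I\}$ is the reduced Gröbner basis of $I$. *Reductions.* Let $F\subseteq RQ$. If a path $p=r\operatorname{tip}(f)s$ with $f\in F$ occurs in $x$ with coefficient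 $\alpha\ne0$, and $\beta$ is the coefficient of $\operatorname{tip}(f)$ in $f$, then $x\to_F\beta x-\alpha\, rfs$ is a simple reduction. A complete reduction of $x$ by $F$ is the final element $y$ of a finite (possibly empty) sequence of simple reductions starting at $x$, where $y=0$ or $y$ admits no simple reduction by $F$. An overlap relation of $x$ and $y$, with tips $t,t'$ having coefficients $\alpha,\beta$ in $x$ and $y$ respectively, is an element $\beta\,xp-\alpha\,qy$ where $p,q$ are paths with $tp=qt'\neq 0$, $\ell(q)\ge1$ and $1\le\ell(p)<\ell(t')$. *The varieties.* Let $\mathcal T\subseteq\mathcal B$ be tip-reduced (no element of $\mathcal T$ is a subpath of another one). Let $\mathcal N$ be the set of paths that have no subpath in $\mathcal T$ and, for $t\in\mathcal T$, let $\mathcal N(t)$ be the set of the $n\in\mathcal N$ with the same origin and terminus as $t$ and $t\succ n$. Put $D=\{(t,n)\mid t\in\mathcal T,\ n\in\mathcal N(t)\}$. For $\mathbf c=(c_{t,n})\in K^D$ put $\mathcal G_{\mathbf c}=\{\,t-\sum_{n\in\mathcal N(t)}c_{t,n}n\mid t\in\mathcal T\,\}$. Let $\mathcal V_{\mathcal T}$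 be the set of the $\mathbf c\in K^D$ such that $\mathcal G_{\mathbf c}$ is the reduced Gröbner basis of the ideal $\langle\mathcal G_{\mathbf c}\rangle$ of $KQ$. Let $m\ge 2$, let $R=K[x_{t,n}\mid (t,n)\in D]$, and let $\mathcal H=\{\,t-\sum_{n\in\mathcal N(t),\,\ell(n)\ge2}x_{t,n}n\mid t\in\mathcal T\,\}\subseteq RQ$. Choose a complete reduction by $\mathcal H$ of every overlap relation of two (possibly equal) elements of $\mathcal H$ and of every path of length $m$. Then $\mathcal V^{ad}_{\mathcal T}(m)\subseteq K^D$ is the zero set of all the coefficients in $R$ of these chosen reductions together with the variables $x_{t,n}$ with $\ell(n)<2$. By an affine algebraic variety we mean the (not necessarily irreducible) zero set in $K^D$, with $D$ finite, of an ideal of polynomials over $K$. **Proposition.** Let $m\ge2$ and let $\mathcal T$ be a tip-reduced set of paths of length at least $2$ with $J^m\subseteq\langle\mathcal T\rangle$. Then the complete reductions in the definition of $\mathcal V^{ad}_{\mathcal T}(m)$ exist, and $\mathcal V^{ad}_{\mathcal T}(m)$ does not depend on the chosen ones. The sets $\mathcal V_{\mathcal T}$ and $\mathcal V^{ad}_{\mathcal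 T}(m)$ are affine algebraic varieties in $K^D$, and $\mathcal V^{ad}_{\mathcal T}(m)$ is a subvariety of $\mathcal V_{\mathcal T}$, that is, $\mathcal V^{ad}_{\mathcal T}(m)\subseteq\mathcal V_{\mathcal T}$. The map $\mathbf c\mapsto KQ/\langle\mathcal G_{\mathbf c}\rangle$ is a bijection from $\mathcal V^{ad}_{\mathcal T}(m)$ onto the set of the algebras $KQ/I$, where $I$ is an ideal with $J^m\subseteq I\subseteq J^2$ whose reduced Gröbner basis has tip set $\mathcal T$; here $KQ/I$ and $KQ/I'$ count as equal only if $I=I'$. All these algebras are finite dimensional over $K$. -/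

import Mathlib

universe u w

noncomputable section

/-- A finite directed path of a quiver, with its origin and terminus; vertices are the paths of
length zero. -/
@[ext]
structure QPath (V : Type u) [Quiver.{w + 1} V] where
  src : V
  tgt : V
  path : Quiver.Path src tgt

namespace QPath

variable {V : Type u} [Quiver.{w + 1} V]

/-- The length of a path. -/
def length (p : QPath V) : ℕ := p.path.length

/-- The path of length zero at a vertex. -/
def vertex (v : V) : QPath V := ⟨v, v, Quiver.Path.nil⟩

/-- The path of length one given by an arrow. -/
def arrow {a b : V} (e : a ⟶ b) : QPath V := ⟨a, b, e.toPath⟩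

/-- The concatenation `pq` ("first `p`, then `q`") of composable paths. -/
def comp (p q : QPath V) (h : p.tgt = q.src) : QPath V :=
  ⟨p.src, q.tgt, p.path.comp (q.path.cast h.symm rfl)⟩

/-- `p` is a subpath of `q`: there are paths `r`, `s` with `q = r p s`. -/
def IsSubpath (p q : QPath V) : Prop :=
  ∃ (a b : V) (r : Quiver.Path a p.src) (s : Quiver.Path p.tgt b),
    q = ⟨a, b, (r.comp p.path).comp s⟩

/-- `p` and `q` have the same origin and the same terminus. -/
def Parallel (p q : QPath V) : Prop := p.src = q.src ∧ p.tgt = q.tgt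

end QPath

/-- `lt` is (the strict part of) an admissible order on the set of paths; `lt q p` means `p ≻ q`.
Products of paths are taken only where they are nonzero, that is, for composable paths. -/
structure IsAdmissibleOrder {V : Type u} [Quiver.{w + 1} V]
    (lt : QPath V → QPath V → Prop) : Prop where
  isWellOrder : IsWellOrder (QPath V) lt
  mul_right : ∀ {a a' b c : V} (p : Quiver.Path a b) (q : Quiver.Path a' b) (r : Quiver.Path b c),
    lt ⟨a', b, q⟩ ⟨a, b, p⟩ → lt ⟨a', c, q.comp r⟩ ⟨a, c, p.comp r⟩
  mul_left : ∀ {a b c c' : V} (s : Quiver.Path a b) (p : Quiver.Path b c) (q : Quiver.Path b c'),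
    lt ⟨b, c', q⟩ ⟨b, c, p⟩ → lt ⟨a, c', s.comp q⟩ ⟨a, c, s.comp p⟩
  subpath : ∀ p q : QPath V, q.IsSubpath p → q = p ∨ lt q p

/-- The path algebra `RQ`: the free `R`-module on the set of paths of `Q`. -/
def PathAlgebra (R : Type*) [CommRing R] (V : Type u) [Quiver.{w + 1} V] : Type _ :=
  QPath V →₀ R

namespace PathAlgebra

variable {R : Type*} [CommRing R] {V : Type u} [Quiver.{w + 1} V]

instance : AddCommGroup (PathAlgebra R V) := inferInstanceAs (AddCommGroup (QPath V →₀ R))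

instance : Module R (PathAlgebra R V) := inferInstanceAs (Module R (QPath V →₀ R))

variable (R V) in
/-- The basis of the path algebra that consists of the paths. -/
def basis : Module.Basis (QPath V) R (PathAlgebra R V) :=
  Module.Basis.ofRepr (LinearEquiv.refl R (QPath V →₀ R))

/-- The coefficient of the path `p` in `x`. -/
def coeff (x : PathAlgebra R V) (p : QPath V) : R := (basis R V).repr x p

variable (R) in
/-- A path, seen as an element of the path algebra. -/
def mono (p : QPath V) : PathAlgebra R V := basis R V p

open scoped Classical in
variable (R) in
/-- The product of two paths in the path algebra: their concatenation if they are composable, and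
`0` otherwise. -/
def pathMul (p q : QPath V) : PathAlgebra R V :=
  if h : p.tgt = q.src then mono R (p.comp q h) else 0

/-- Multiplication of the path algebra, the bilinear extension of the product of paths. -/
def mulHom : PathAlgebra R V →ₗ[R] PathAlgebra R V →ₗ[R] PathAlgebra R V :=
  (basis R V).constr R fun p => (basis R V).constr R fun q => pathMul R p q

instance : Mul (PathAlgebra R V) := ⟨fun x y => mulHom x y⟩

theorem mul_def (x y : PathAlgebra R V) : x * y = mulHom x y := rfl

theorem mono_mul_mono (p q : QPath V) : mono R p * mono R q = pathMul R p q := by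
  simp [mul_def, mono, mulHom, Module.Basis.constr_basis]

theorem mono_mul_assoc (p q r : QPath V) :
    mono R p * mono R q * mono R r = mono R p * (mono R q * mono R r) := by
  obtain ⟨a, b, p⟩ := p
  obtain ⟨b', c, q⟩ := q
  obtain ⟨c', d, r⟩ := r
  have z1 : ∀ x : PathAlgebra R V, 0 * x = 0 := fun x => by rw [mul_def, map_zero]; rfl
  have z2 : ∀ x : PathAlgebra R V, x * 0 = 0 := fun x => by rw [mul_def, map_zero]
  rw [mono_mul_mono, mono_mul_mono]
  unfold pathMul
  by_cases h : b = b'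
  · subst h
    by_cases h' : c = c'
    · subst h'
      simp [mono_mul_mono, pathMul, QPath.comp, Quiver.Path.comp_assoc]
    · simp [mono_mul_mono, pathMul, QPath.comp, h', z2]
  · by_cases h' : c = c'
    · subst h'
      simp [mono_mul_mono, pathMul, QPath.comp, h, z1]
    · simp [h, h', z1, z2]

variable [Fintype V]

/-- The unit of the path algebra is the sum of the vertices. -/
instance : One (PathAlgebra R V) := ⟨∑ v : V, mono R (QPath.vertex v)⟩

theorem one_def : (1 : PathAlgebra R V) = ∑ v : V, mono R (QPath.vertex v) := rfl

theorem one_mul_mono (p : QPath V) : 1 * mono R p = mono R p := by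
  classical
  have h : ∀ v : V, mulHom (mono R (QPath.vertex v)) (mono R p)
      = if v = p.src then mono R p else 0 := fun v => by
    rw [← mul_def, mono_mul_mono]
    unfold pathMul
    obtain ⟨a, b, p⟩ := p
    by_cases h : v = a
    · subst h
      simp [QPath.vertex, QPath.comp]
    · simp [QPath.vertex, h]
  rw [mul_def, one_def, map_sum, LinearMap.sum_apply]
  simp [h]

theorem mono_mul_one (p : QPath V) : mono R p * 1 = mono R p := by
  classical
  have h : ∀ v : V, mulHom (mono R p) (mono R (QPath.vertex v))
      = if p.tgt = v then mono R p else 0 := fun v => by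
    rw [← mul_def, mono_mul_mono]
    unfold pathMul
    obtain ⟨a, b, p⟩ := p
    by_cases h : b = v
    · subst h
      simp [QPath.vertex, QPath.comp]
    · simp [QPath.vertex, h]
  rw [mul_def, one_def, map_sum]
  simp [h]

instance : Ring (PathAlgebra R V) :=
  { (inferInstance : AddCommGroup (PathAlgebra R V)),
    (inferInstance : Mul (PathAlgebra R V)),
    (inferInstance : One (PathAlgebra R V)) with
    left_distrib := fun x y z => by simp only [mul_def, map_add]
    right_distrib := fun x y z => by simp only [mul_def, map_add, LinearMap.add_apply]
    zero_mul := fun x => by rw [mul_def, map_zero]; rfl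
    mul_zero := fun x => by rw [mul_def, map_zero]
    mul_assoc := fun x y z => by
      have h : ∀ (f g : PathAlgebra R V →ₗ[R] PathAlgebra R V),
          (∀ p, f (mono R p) = g (mono R p)) → ∀ x, f x = g x := fun f g hfg x =>
        LinearMap.congr_fun ((basis R V).ext hfg) x
      have h1 : ∀ p q z, mono R p * mono R q * z = mono R p * (mono R q * z) := fun p q =>
        h (mulHom (mono R p * mono R q)) (mulHom (mono R p) ∘ₗ mulHom (mono R q))
          fun r => mono_mul_assoc p q r
      have h2 : ∀ p y z, mono R p * y * z = mono R p * (y * z) := fun p y z =>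
        h (mulHom.flip z ∘ₗ mulHom (mono R p)) (mulHom (mono R p) ∘ₗ mulHom.flip z)
          (fun q => h1 p q z) y
      exact h (mulHom.flip z ∘ₗ mulHom.flip y) (mulHom.flip (y * z)) (fun p => h2 p y z) x
    one_mul := fun x => by
      have h : mulHom (1 : PathAlgebra R V) = LinearMap.id :=
        (basis R V).ext fun p => one_mul_mono p
      rw [mul_def, h]; rfl
    mul_one := fun x => by
      have h : mulHom.flip (1 : PathAlgebra R V) = LinearMap.id :=
        (basis R V).ext fun p => mono_mul_one p
      exact LinearMap.congr_fun h x }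

instance : Algebra R (PathAlgebra R V) :=
  Algebra.ofModule (fun r x y => by simp only [mul_def, map_smul, LinearMap.smul_apply])
    (fun r x y => by simp only [mul_def, map_smul])

end PathAlgebra

section Groebner

variable {R : Type*} [CommRing R] {V : Type u} [Quiver.{w + 1} V]

open PathAlgebra

/-- `p` is the tip of `x`: the largest path that occurs in `x`. (The element `0` has no tip.) -/
def IsTip (lt : QPath V → QPath V → Prop) (x : PathAlgebra R V) (p : QPath V) : Prop :=
  coeff x p ≠ 0 ∧ ∀ q, coeff x q ≠ 0 → q = p ∨ lt q p

/-- The set of tips of the nonzero elements of `X`. -/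
def tipSet (lt : QPath V → QPath V → Prop) (X : Set (PathAlgebra R V)) : Set (QPath V) :=
  {p | ∃ x ∈ X, IsTip lt x p}

/-- No element of the set `T` of paths is a subpath of another one. -/
def TipReduced (T : Set (QPath V)) : Prop :=
  ∀ s ∈ T, ∀ t ∈ T, s ≠ t → ¬ s.IsSubpath t

variable [Fintype V]

variable (R V) in
/-- The two-sided ideal `J` of the path algebra generated by the arrows. -/
def arrowIdeal : TwoSidedIdeal (PathAlgebra R V) :=
  TwoSidedIdeal.span {x | ∃ (a b : V) (e : a ⟶ b), x = mono R (QPath.arrow e)}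

variable (R) in
/-- The two-sided ideal `⟨T⟩` generated by a set of paths. -/
def pathIdeal (T : Set (QPath V)) : TwoSidedIdeal (PathAlgebra R V) :=
  TwoSidedIdeal.span (mono R '' T)

/-- The nontips of the ideal `I`: the paths that are not the tip of an element of `I`. -/
def nontips (lt : QPath V → QPath V → Prop) (I : TwoSidedIdeal (PathAlgebra R V)) :
    Set (QPath V) :=
  {p | p ∉ tipSet lt (I : Set (PathAlgebra R V))}

/-- `G` is the reduced Gröbner basis of the ideal `I`: with `T` the (unique) minimal set of paths
that generates the ideal `⟨tip(I)⟩`, it is the set of the elements `g_t` (`t ∈ T`) of `I` such that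
`t - g_t` is a linear combination of nontips of `I`. -/
def IsReducedGroebnerBasis (lt : QPath V → QPath V → Prop) (G : Set (PathAlgebra R V))
    (I : TwoSidedIdeal (PathAlgebra R V)) : Prop :=
  ∃ T : Set (QPath V),
    Minimal (fun S => pathIdeal R S = pathIdeal R (tipSet lt (I : Set (PathAlgebra R V)))) T ∧
    G = {g | g ∈ I ∧ ∃ t ∈ T, mono R t - g ∈ Submodule.span R (mono R '' nontips lt I)}

/-- `x →_F y`: a simple reduction of `x` by `F`. If the path `p = r t s` occurs in `x`, where `t` is
the tip of some `f ∈ F` with coefficient `β`, then `y = β x - α r f s` with `α` the coefficient of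
`p` in `x`. -/
def SimpleReduction (lt : QPath V → QPath V → Prop) (F : Set (PathAlgebra R V))
    (x y : PathAlgebra R V) : Prop :=
  ∃ f ∈ F, ∃ t : QPath V, IsTip lt f t ∧
    ∃ (a b : V) (r : Quiver.Path a t.src) (s : Quiver.Path t.tgt b),
      coeff x ⟨a, b, (r.comp t.path).comp s⟩ ≠ 0 ∧
      y = coeff f t • x -
        coeff x ⟨a, b, (r.comp t.path).comp s⟩ • (mono R ⟨a, t.src, r⟩ * f * mono R ⟨t.tgt, b, s⟩)

/-- `x ⇒_F y`: a complete reduction of `x` by `F`, that is, a finite sequence of simple reductions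
from `x` to `y`, where `y` is `0` or has no simple reduction. -/
def CompleteReduction (lt : QPath V → QPath V → Prop) (F : Set (PathAlgebra R V))
    (x y : PathAlgebra R V) : Prop :=
  Relation.ReflTransGen (SimpleReduction lt F) x y ∧ (y = 0 ∨ ∀ z, ¬ SimpleReduction lt F y z)

/-- `o` is an overlap relation of `x` and `y`: with `t`, `t'` the tips of `x` and `y`, one has
`o = β x m - α n y`, where `t m = n t'` for paths `m`, `n` of positive length, `m` is shorter than
`t'`, and `α`, `β` are the coefficients of `t` in `x` and of `t'` in `y`. -/
def IsOverlapRelation (lt : QPath V → QPath V → Prop) (x y o : PathAlgebra R V) : Prop :=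
  ∃ t t' : QPath V, IsTip lt x t ∧ IsTip lt y t' ∧
    ∃ (a c : V) (m : Quiver.Path t.tgt c) (n : Quiver.Path a t'.src),
      (⟨t.src, c, t.path.comp m⟩ : QPath V) = ⟨a, t'.tgt, n.comp t'.path⟩ ∧
      1 ≤ n.length ∧ 1 ≤ m.length ∧ m.length < t'.length ∧
      o = coeff y t' • (x * mono R ⟨t.tgt, c, m⟩) - coeff x t • (mono R ⟨a, t'.src, n⟩ * y)

end Groebner

section Varieties

variable {V : Type u} [Quiver.{w + 1} V]

open PathAlgebra

/-- The set `N` of the paths that have no subpath in `T`; these are the nontips of `⟨T⟩`. -/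
def normalPaths (T : Set (QPath V)) : Set (QPath V) :=
  {p | ∀ t ∈ T, ¬ t.IsSubpath p}

/-- The set `N(t)` of the paths in `N` that are parallel to `t` and smaller than `t`. -/
def normalPathsBelow (lt : QPath V → QPath V → Prop) (T : Set (QPath V)) (t : QPath V) :
    Set (QPath V) :=
  {n | n ∈ normalPaths T ∧ n.Parallel t ∧ lt n t}

/-- The index set of the coordinates `c_{t,n}`, for `t ∈ T` and `n ∈ N(t)`. -/
abbrev Coord (lt : QPath V → QPath V → Prop) (T : Set (QPath V)) : Type _ :=
  (t : T) × normalPathsBelow lt T t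

/-- The set of the elements `g_t = t - ∑_{n ∈ N(t)} c_{t,n} n`, for `t ∈ T`. -/
def genSet {R : Type*} [CommRing R] (lt : QPath V → QPath V → Prop) (T : Set (QPath V))
    (c : Coord lt T → R) : Set (PathAlgebra R V) :=
  Set.range fun t : T =>
    mono R t.1 - ∑ᶠ n : normalPathsBelow lt T t, c ⟨t, n⟩ • mono R n.1

variable [Fintype V]

/-- The ideal `⟨g_t : t ∈ T⟩` of the path algebra that a point `c` defines. -/
def idealOfPoint {R : Type*} [CommRing R] (lt : QPath V → QPath V → Prop) (T : Set (QPath V))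
    (c : Coord lt T → R) : TwoSidedIdeal (PathAlgebra R V) :=
  TwoSidedIdeal.span (genSet lt T c)

variable (K : Type*) [Field K] (lt : QPath V → QPath V → Prop) (T : Set (QPath V))

/-- `V_T`: the points `c` for which the set of the `g_t` is the reduced Gröbner basis of the ideal
that it generates. -/
def varietyOfTips : Set (Coord lt T → K) :=
  {c | IsReducedGroebnerBasis lt (genSet lt T c) (idealOfPoint lt T c)}

/-- The set `H` of the generic elements `h_t = t - ∑ x_{t,n} n`, the sum over the `n ∈ N(t)` of
length at least `2`, with coefficients in the polynomial ring in the variables `x_{t,n}`. -/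
def genericSet : Set (PathAlgebra (MvPolynomial (Coord lt T) K) V) :=
  genSet lt T fun i : Coord lt T => if 2 ≤ i.2.1.length then MvPolynomial.X i else 0

/-- The overlap relations of the elements of `H`. -/
def genericOverlaps : Set (PathAlgebra (MvPolynomial (Coord lt T) K) V) :=
  {o | ∃ h ∈ genericSet K lt T, ∃ h' ∈ genericSet K lt T, IsOverlapRelation lt h h' o}

/-- The paths of length `m`, as elements of the path algebra over the polynomial ring. -/
def pathsOfLength (m : ℕ) : Set (PathAlgebra (MvPolynomial (Coord lt T) K) V) :=
  {x | ∃ p : QPath V, p.length = m ∧ x = mono _ p}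

/-- `ρ` chooses a complete reduction by `H` of every overlap relation of `H` and of every path of
length `m`. -/
def IsReductionChoice (m : ℕ) (ρ : PathAlgebra (MvPolynomial (Coord lt T) K) V →
    PathAlgebra (MvPolynomial (Coord lt T) K) V) : Prop :=
  ∀ x ∈ genericOverlaps K lt T ∪ pathsOfLength K lt T m,
    CompleteReduction lt (genericSet K lt T) x (ρ x)

/-- The polynomials that define `V_T^ad(m)`: the variables `x_{t,n}` with `n` of length less
than `2`, the coefficients `f_i` of the chosen complete reductions of the overlap relations of `H`,
and the coefficients `f_j^*` of the chosen complete reductions of the paths of length `m`. -/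
def admissibleEquations (m : ℕ) (ρ : PathAlgebra (MvPolynomial (Coord lt T) K) V →
    PathAlgebra (MvPolynomial (Coord lt T) K) V) : Set (MvPolynomial (Coord lt T) K) :=
  {f | ∃ i : Coord lt T, i.2.1.length < 2 ∧ f = MvPolynomial.X i} ∪
  {f | ∃ o ∈ genericOverlaps K lt T, ∃ n, f = coeff (ρ o) n} ∪
  {f | ∃ x ∈ pathsOfLength K lt T m, ∃ n, f = coeff (ρ x) n}

/-- `V_T^ad(m)`: the zero set of the ideal generated by these polynomials. -/
def admissibleVariety (m : ℕ) (ρ : PathAlgebra (MvPolynomial (Coord lt T) K) V →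
    PathAlgebra (MvPolynomial (Coord lt T) K) V) : Set (Coord lt T → K) :=
  MvPolynomial.zeroLocus K (Ideal.span (admissibleEquations K lt T m ρ))

/-- An affine algebraic variety in the affine space `K^σ`: the set of common zeros of an ideal of
polynomials (not necessarily irreducible), the index set `σ` being finite. -/
def IsAffineVariety {K : Type*} [Field K] {σ : Type*} (S : Set (σ → K)) : Prop :=
  Finite σ ∧ ∃ I : Ideal (MvPolynomial σ K), S = MvPolynomial.zeroLocus K I

/-- The ideals `I` of the path algebra with `J^m ⊆ I ⊆ J^2` whose reduced Gröbner basis has tip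
set `T`; the ideal `I` stands for the algebra `KQ/I`. -/
def admissibleIdeals (m : ℕ) : Set (TwoSidedIdeal (PathAlgebra K V)) :=
  {I | (arrowIdeal K V).asIdeal ^ m ≤ I.asIdeal ∧ I.asIdeal ≤ (arrowIdeal K V).asIdeal ^ 2 ∧
    ∃ G, IsReducedGroebnerBasis lt G I ∧ tipSet lt G = T}

end Varieties

end

/-! Call a path normal if it has no subpath in `T`. Since `J^m ⊆ ⟨T⟩`, normal paths are shorter than
`m` and elements of `T` have length at most `m`, so the coordinate space is finite dimensional. For
a point `c` over `K` every `t` is a tip of the ideal of `c`, hence normal paths span `KQ` modulo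
that ideal. Everything turns on whether they stay independent there, which is `NormalPartTrivial`.
By `mem_varietyOfTips_iff` this condition defines `V_T`. Under it the tail of `g_t` is the normal
form of `t`, so the ideal determines `c`; conversely, an ideal whose nontips are the normal paths
comes from the normal forms of the `t` (`exists_idealOfPoint_eq`).

That the condition is polynomial in `c` rests on the diamond lemma `eq_zero_of_mem_idealOfPoint`: it
suffices that each overlap relation is a combination of elements `r g_t s` with `r t s` below the
overlap path. The `g_t` are monic, so this works over any commutative ring, in particular for
generic coefficients. Specializing the variables need not turn a reduction sequence into a reduction
sequence, because coefficients may vanish, but it preserves the bounded combination that expresses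
`o - ρ o`. This gives `normalPartTrivial_iff`.

Once normal paths are independent at a point, a specialized remainder vanishes exactly when the
specialized element lies in the ideal (`mapCoeff_mem_idealOfPoint_iff`). For paths of length `m`
this encodes `J^m ⊆ I`, while vanishing of the short coordinates encodes `I ⊆ J^2`. The resulting
description `mem_admissibleVariety_iff` does not mention the chosen reductions; independence of the
choice, the inclusion and the bijection follow from it. -/

noncomputable section

/-! ### Combinatorics of paths: factorizations, subpaths, finiteness. -/

namespace Quiver.Path

variable {V : Type u} [Quiver.{w + 1} V]

/-- Two factorizations of a path have a common refinement. -/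
theorem exists_comp_of_comp_eq_comp {a b c : V} (p : Path a b) (q : Path b c) :
    ∀ {b' : V} (p' : Path a b') (q' : Path b' c), p.comp q = p'.comp q' →
      p.length ≤ p'.length → ∃ u : Path b b', p' = p.comp u ∧ q = u.comp q' := by
  intro b' p' q' h hl
  induction q' with
  | nil => exact ⟨q, h.symm, rfl⟩
  | cons q' e ih =>
    cases q with
    | nil =>
      have := congrArg length h
      simp only [length_comp, length_cons, length_nil] at this
      omega
    | cons q f =>
      simp only [comp_cons] at h
      obtain rfl := obj_eq_of_cons_eq_cons h
      obtain ⟨u, hu, hu'⟩ := ih q (eq_of_heq (heq_of_cons_eq_cons h))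
      exact ⟨u, hu, by rw [comp_cons, ← hu', eq_of_heq (hom_heq_of_cons_eq_cons h)]⟩

/-- A path of length at least `k` has an initial subpath of length `k`. -/
theorem exists_eq_comp_length_eq {a b : V} (p : Path a b) (k : ℕ) (hk : k ≤ p.length) :
    ∃ (c : V) (r : Path a c) (s : Path c b), p = r.comp s ∧ r.length = k := by
  induction p with
  | nil => exact ⟨_, nil, nil, rfl, by simp at hk; simp [hk]⟩
  | cons p e ih =>
    by_cases h : k ≤ p.length
    · obtain ⟨c, r, s, rfl, hr⟩ := ih h
      exact ⟨c, r, s.cons e, rfl, hr⟩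
    · refine ⟨_, p.cons e, nil, rfl, ?_⟩
      simp only [length_cons] at hk ⊢
      omega

end Quiver.Path

namespace QPath

variable {V : Type u} [Quiver.{w + 1} V]

open Quiver

theorem IsSubpath.refl (p : QPath V) : p.IsSubpath p :=
  ⟨p.src, p.tgt, Path.nil, Path.nil, by simp⟩

theorem IsSubpath.trans {p q r : QPath V} (h : p.IsSubpath q) (h' : q.IsSubpath r) :
    p.IsSubpath r := by
  obtain ⟨a, b, x, y, rfl⟩ := h
  obtain ⟨c, d, z, t, rfl⟩ := h'
  exact ⟨c, d, z.comp x, y.comp t, by simp [Path.comp_assoc]⟩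

theorem IsSubpath.length_le {p q : QPath V} (h : p.IsSubpath q) : p.length ≤ q.length := by
  obtain ⟨a, b, x, y, rfl⟩ := h
  simp only [length, Path.length_comp]
  omega

theorem IsSubpath.eq_of_length_le {p q : QPath V} (h : p.IsSubpath q)
    (h' : q.length ≤ p.length) : p = q := by
  obtain ⟨a, b, p⟩ := p
  obtain ⟨c, d, x, y, rfl⟩ := h
  simp only [length, Path.length_comp] at h'
  have hx : x.length = 0 := by omega
  have hy : y.length = 0 := by omega
  obtain rfl := Path.eq_of_length_zero x hx
  obtain rfl := Path.eq_of_length_zero y hy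
  rw [Path.eq_nil_of_length_zero x hx, Path.eq_nil_of_length_zero y hy]
  simp

theorem finite_length_eq [Finite V] [∀ a b : V, Finite (a ⟶ b)] (k : ℕ) :
    {p : QPath V | p.length = k}.Finite := by
  induction k with
  | zero =>
    refine (Set.finite_range (fun v : V => vertex v)).subset ?_
    rintro ⟨a, b, p⟩ (hp : p.length = 0)
    obtain rfl := Path.eq_of_length_zero p hp
    exact ⟨a, by rw [Path.eq_nil_of_length_zero p hp]; rfl⟩
  | succ k ih =>
    have : Finite {p : QPath V | p.length = k} := ih
    refine (Set.finite_range
      (fun x : (p : {p : QPath V | p.length = k}) × (b : V) × (p.1.tgt ⟶ b) =>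
        (⟨x.1.1.src, x.2.1, x.1.1.path.cons x.2.2⟩ : QPath V))).subset ?_
    rintro ⟨a, b, p⟩ (hp : p.length = k + 1)
    cases p with
    | nil => simp at hp
    | cons p e => exact ⟨⟨⟨⟨a, _, p⟩, by simpa [length] using hp⟩, ⟨_, e⟩⟩, rfl⟩

theorem finite_length_lt [Finite V] [∀ a b : V, Finite (a ⟶ b)] (k : ℕ) :
    {p : QPath V | p.length < k}.Finite := by
  refine ((Set.finite_lt_nat k).biUnion fun i _ => finite_length_eq i).subset fun p hp => ?_
  simp only [Set.mem_iUnion]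
  exact ⟨p.length, hp, rfl⟩

end QPath

namespace IsAdmissibleOrder

variable {V : Type u} [Quiver.{w + 1} V] {lt : QPath V → QPath V → Prop}

theorem wf (h : IsAdmissibleOrder lt) : WellFounded lt := h.isWellOrder.wf

theorem irrefl (h : IsAdmissibleOrder lt) (p : QPath V) : ¬ lt p p :=
  fun hp => h.wf.irrefl.irrefl p hp

theorem trans (h : IsAdmissibleOrder lt) {p q r : QPath V} : lt p q → lt q r → lt p r :=
  have := h.isWellOrder
  fun h1 h2 => _root_.trans h1 h2

theorem trichotomous (h : IsAdmissibleOrder lt) (p q : QPath V) : lt p q ∨ p = q ∨ lt q p := by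
  have := h.isWellOrder
  exact Std.Trichotomous.rel_or_eq_or_rel_swap

end IsAdmissibleOrder

/-! ### Spans of paths, monomial ideals and powers of the arrow ideal. -/

namespace PathAlgebra

variable {R : Type*} [CommRing R] {V : Type u} [Quiver.{w + 1} V]

open Quiver

variable (R) in
/-- The span of a set of paths. -/
def pathSpan (S : Set (QPath V)) : Submodule R (PathAlgebra R V) :=
  Submodule.span R (mono R '' S)

variable (R V) in
/-- The coordinate functionals with respect to the basis of paths. -/
def coeffHom (p : QPath V) : PathAlgebra R V →ₗ[R] R := (basis R V).coord p

@[simp] theorem coeffHom_apply (p : QPath V) (x : PathAlgebra R V) :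
    coeffHom R V p x = coeff x p := rfl

@[simp] theorem coeff_zero (p : QPath V) : coeff (0 : PathAlgebra R V) p = 0 :=
  map_zero (coeffHom R V p)

@[simp] theorem coeff_add (x y : PathAlgebra R V) (p : QPath V) :
    coeff (x + y) p = coeff x p + coeff y p := map_add (coeffHom R V p) x y

@[simp] theorem coeff_sub (x y : PathAlgebra R V) (p : QPath V) :
    coeff (x - y) p = coeff x p - coeff y p := map_sub (coeffHom R V p) x y

@[simp] theorem coeff_smul (r : R) (x : PathAlgebra R V) (p : QPath V) :
    coeff (r • x) p = r * coeff x p := map_smul (coeffHom R V p) r x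

open scoped Classical in
theorem coeff_mono (p q : QPath V) : coeff (mono R p) q = if p = q then 1 else 0 := by
  simp [coeff, mono, Finsupp.single_apply]

@[simp] theorem coeff_mono_self (p : QPath V) : coeff (mono R p) p = 1 := by
  simp [coeff_mono]

theorem coeff_mono_of_ne {p q : QPath V} (h : p ≠ q) : coeff (mono R p) q = 0 := by
  simp [coeff_mono, h]

theorem ext_coeff {x y : PathAlgebra R V} (h : ∀ p, coeff x p = coeff y p) : x = y :=
  (basis R V).ext_elem h

theorem finite_support (x : PathAlgebra R V) : {p | coeff x p ≠ 0}.Finite :=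
  (((basis R V).repr x).support.finite_toSet).subset fun p hp => by
    simpa using (show (basis R V).repr x p ≠ 0 from hp)

theorem mem_pathSpan {S : Set (QPath V)} {x : PathAlgebra R V} :
    x ∈ pathSpan R S ↔ ∀ p, coeff x p ≠ 0 → p ∈ S := by
  rw [pathSpan]
  refine ((basis R V).mem_span_image).trans ?_
  simp only [Set.subset_def, SetLike.mem_coe, Finsupp.mem_support_iff]
  rfl

theorem mono_mem_pathSpan {S : Set (QPath V)} {p : QPath V} (h : p ∈ S) :
    mono R p ∈ pathSpan R S := Submodule.subset_span ⟨p, h, rfl⟩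

theorem pathSpan_mono {S S' : Set (QPath V)} (h : S ⊆ S') : pathSpan R S ≤ pathSpan R S' :=
  Submodule.span_mono (Set.image_mono h)

theorem mem_pathSpan_univ (x : PathAlgebra R V) : x ∈ pathSpan R (Set.univ : Set (QPath V)) :=
  mem_pathSpan.2 fun _ _ => trivial

theorem exists_coeff_ne_zero {x : PathAlgebra R V} (h : x ≠ 0) : ∃ p, coeff x p ≠ 0 := by
  by_contra! h'
  exact h (ext_coeff (by simpa using h'))

theorem exists_isTip {lt : QPath V → QPath V → Prop} (hlt : IsAdmissibleOrder lt)
    {x : PathAlgebra R V} (h : x ≠ 0) : ∃ p, IsTip lt x p := by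
  have := hlt.isWellOrder
  classical
  let := linearOrderOfSTO lt
  obtain ⟨p, hp, hp'⟩ := Set.exists_max_image {p | coeff x p ≠ 0} id (finite_support x)
    (exists_coeff_ne_zero h)
  exact ⟨p, hp, hp'⟩

theorem _root_.IsTip.unique {lt : QPath V → QPath V → Prop} (hlt : IsAdmissibleOrder lt)
    {x : PathAlgebra R V} {p q : QPath V} (hp : IsTip lt x p) (hq : IsTip lt x q) : p = q := by
  rcases hp.2 q hq.1 with h | h
  · exact h.symm
  · rcases hq.2 p hp.1 with h' | h'
    · exact h'
    · exact (hlt.irrefl _ (hlt.trans h h')).elim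

variable [Fintype V]

omit [Fintype V] in
theorem mono_mul_mono_comp {a b c : V} (p : Path a b) (q : Path b c) :
    mono R (⟨a, b, p⟩ : QPath V) * mono R ⟨b, c, q⟩ = mono R ⟨a, c, p.comp q⟩ := by
  rw [mono_mul_mono, pathMul, dif_pos rfl]
  rfl

theorem mono_mul_mono_of_ne {p q : QPath V} (h : p.tgt ≠ q.src) : mono R p * mono R q = 0 := by
  rw [mono_mul_mono, pathMul, dif_neg h]

/-- Left multiplication by a path maps the span of `S` into the span of `S'`. -/
theorem mono_mul_mem_pathSpan {S S' : Set (QPath V)} {a b : V} (r : Path a b)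
    (h : ∀ (c : V) (q : Path b c), ⟨b, c, q⟩ ∈ S → ⟨a, c, r.comp q⟩ ∈ S')
    {x : PathAlgebra R V} (hx : x ∈ pathSpan R S) : mono R ⟨a, b, r⟩ * x ∈ pathSpan R S' := by
  induction hx using Submodule.span_induction with
  | mem x hx =>
    obtain ⟨⟨b', c, q⟩, hq, rfl⟩ := hx
    by_cases hb : b = b'
    · subst hb
      rw [mono_mul_mono_comp]
      exact mono_mem_pathSpan (h c q hq)
    · rw [mono_mul_mono_of_ne hb]
      exact zero_mem _
  | zero => rw [mul_zero]; exact zero_mem _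
  | add x y _ _ hx hy => rw [mul_add]; exact add_mem hx hy
  | smul k x _ hx => rw [mul_smul_comm]; exact Submodule.smul_mem _ _ hx

/-- Right multiplication by a path maps the span of `S` into the span of `S'`. -/
theorem mul_mono_mem_pathSpan {S S' : Set (QPath V)} {b c : V} (s : Path b c)
    (h : ∀ (a : V) (q : Path a b), ⟨a, b, q⟩ ∈ S → ⟨a, c, q.comp s⟩ ∈ S')
    {x : PathAlgebra R V} (hx : x ∈ pathSpan R S) : x * mono R ⟨b, c, s⟩ ∈ pathSpan R S' := by
  induction hx using Submodule.span_induction with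
  | mem x hx =>
    obtain ⟨⟨a, b', q⟩, hq, rfl⟩ := hx
    by_cases hb : b' = b
    · subst hb
      rw [mono_mul_mono_comp]
      exact mono_mem_pathSpan (h a q hq)
    · rw [mono_mul_mono_of_ne hb]
      exact zero_mem _
  | zero => rw [zero_mul]; exact zero_mem _
  | add x y _ _ hx hy => rw [add_mul]; exact add_mem hx hy
  | smul k x _ hx => rw [smul_mul_assoc]; exact Submodule.smul_mem _ _ hx

theorem mono_vertex_mul_mul_mono_vertex {a b : V} {x : PathAlgebra R V}
    (hx : x ∈ pathSpan R {q | q.src = a ∧ q.tgt = b}) :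
    mono R ⟨a, a, Path.nil⟩ * x * mono R ⟨b, b, Path.nil⟩ = x := by
  induction hx using Submodule.span_induction with
  | mem x hx =>
    obtain ⟨⟨a, b, q⟩, ⟨rfl, rfl⟩, rfl⟩ := hx
    simp only
    rw [mono_mul_mono_comp, mono_mul_mono_comp, Path.nil_comp, Path.comp_nil]
  | zero => simp
  | add x y _ _ hx hy => rw [mul_add, add_mul, hx, hy]
  | smul k x _ hx => rw [mul_smul_comm, smul_mul_assoc, hx]

theorem _root_.TwoSidedIdeal.algebra_smul_mem (I : TwoSidedIdeal (PathAlgebra R V)) (k : R)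
    {x : PathAlgebra R V} (hx : x ∈ I) : k • x ∈ I := by
  rw [Algebra.smul_def]
  exact I.mul_mem_left _ _ hx

/-- A two-sided ideal of the path algebra, as a submodule. -/
def _root_.TwoSidedIdeal.toPathSubmodule (I : TwoSidedIdeal (PathAlgebra R V)) :
    Submodule R (PathAlgebra R V) where
  carrier := I
  add_mem' := I.add_mem
  zero_mem' := I.zero_mem
  smul_mem' k _ hx := I.algebra_smul_mem k hx

/-- A submodule that is stable under multiplication by paths contains the ideal generated by each
of its subsets. -/
theorem span_subset_of_mono_mul_mem {G : Set (PathAlgebra R V)}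
    {W : Submodule R (PathAlgebra R V)} (hG : G ⊆ W) (hl : ∀ p, ∀ x ∈ W, mono R p * x ∈ W)
    (hr : ∀ p, ∀ x ∈ W, x * mono R p ∈ W) {x : PathAlgebra R V}
    (hx : x ∈ TwoSidedIdeal.span G) : x ∈ W := by
  have hl' : ∀ y, ∀ x ∈ W, y * x ∈ W := fun y x hx => by
    have hy := mem_pathSpan_univ y
    induction hy using Submodule.span_induction with
    | mem y hy => obtain ⟨p, -, rfl⟩ := hy; exact hl p x hx
    | zero => rw [zero_mul]; exact zero_mem _
    | add y z _ _ hy hz => rw [add_mul]; exact add_mem hy hz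
    | smul k y _ hy => rw [smul_mul_assoc]; exact Submodule.smul_mem _ _ hy
  have hr' : ∀ y, ∀ x ∈ W, x * y ∈ W := fun y x hx => by
    have hy := mem_pathSpan_univ y
    induction hy using Submodule.span_induction with
    | mem y hy => obtain ⟨p, -, rfl⟩ := hy; exact hr p x hx
    | zero => rw [mul_zero]; exact zero_mem _
    | add y z _ _ hy hz => rw [mul_add]; exact add_mem hy hz
    | smul k y _ hy => rw [mul_smul_comm]; exact Submodule.smul_mem _ _ hy
  rw [TwoSidedIdeal.mem_span_iff_mem_addSubgroup_closure] at hx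
  refine (AddSubgroup.closure_le (K := W.toAddSubgroup)).2 ?_ hx
  rintro _ ⟨_, ⟨y, -, g, hg, rfl⟩, z, -, rfl⟩
  exact hr' z _ (hl' y _ (hG hg))

/-- The paths divisible by an element of `S` span a submodule stable under multiplication by paths,
so membership of a single path can be read off from its coefficient. -/
theorem mono_mem_pathIdeal [Nontrivial R] {S : Set (QPath V)} {p : QPath V} :
    mono R p ∈ pathIdeal R S ↔ ∃ t ∈ S, t.IsSubpath p := by
  constructor
  · intro h
    have : mono R p ∈ pathSpan R {p | ∃ t ∈ S, t.IsSubpath p} := by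
      refine span_subset_of_mono_mul_mem ?_ ?_ ?_ h
      · rintro _ ⟨t, ht, rfl⟩
        exact mono_mem_pathSpan ⟨t, ht, .refl t⟩
      · rintro ⟨a, b, r⟩ x hx
        refine mono_mul_mem_pathSpan r ?_ hx
        rintro c q ⟨t, ht, hq⟩
        exact ⟨t, ht, hq.trans ⟨_, _, r, Path.nil, rfl⟩⟩
      · rintro ⟨a, b, r⟩ x hx
        refine mul_mono_mem_pathSpan r ?_ hx
        rintro c q ⟨t, ht, hq⟩
        exact ⟨t, ht, hq.trans ⟨_, _, Path.nil, r, by simp⟩⟩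
    exact mem_pathSpan.1 this p (by simp)
  · rintro ⟨⟨c, d, t⟩, ht, a, b, r, s, rfl⟩
    rw [← mono_mul_mono_comp, ← mono_mul_mono_comp]
    exact TwoSidedIdeal.mul_mem_right _ _ _ (TwoSidedIdeal.mul_mem_left _ _ _
      (TwoSidedIdeal.subset_span ⟨_, ht, rfl⟩))

theorem mem_arrowIdeal {x : PathAlgebra R V} (hx : x ∈ arrowIdeal R V) :
    x ∈ pathSpan R {p | 1 ≤ p.length} := by
  refine span_subset_of_mono_mul_mem ?_ ?_ ?_ hx
  · rintro _ ⟨a, b, e, rfl⟩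
    exact mono_mem_pathSpan (show 1 ≤ e.toPath.length by simp)
  · rintro ⟨a, b, r⟩ x hx
    refine mono_mul_mem_pathSpan r (fun c q hq => ?_) hx
    simp only [QPath.length, Set.mem_ofPred_eq, Path.length_comp] at hq ⊢
    omega
  · rintro ⟨a, b, r⟩ x hx
    refine mul_mono_mem_pathSpan r (fun c q hq => ?_) hx
    simp only [QPath.length, Set.mem_ofPred_eq, Path.length_comp] at hq ⊢
    omega

theorem mul_mem_pathSpan_length {i j : ℕ} {x y : PathAlgebra R V}
    (hx : x ∈ pathSpan R {p | i ≤ p.length}) (hy : y ∈ pathSpan R {p | j ≤ p.length}) :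
    x * y ∈ pathSpan R {p | i + j ≤ p.length} := by
  induction hx using Submodule.span_induction with
  | mem x hx =>
    obtain ⟨⟨a, b, r⟩, hr, rfl⟩ := hx
    refine mono_mul_mem_pathSpan r (fun c q hq => ?_) hy
    simp only [QPath.length, Set.mem_ofPred_eq, Path.length_comp] at hq hr ⊢
    omega
  | zero => rw [zero_mul]; exact zero_mem _
  | add y z _ _ hy hz => rw [add_mul]; exact add_mem hy hz
  | smul k y _ hy => rw [smul_mul_assoc]; exact Submodule.smul_mem _ _ hy

theorem mono_mem_arrowIdeal_pow (k : ℕ) : ∀ p : QPath V, k ≤ p.length →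
    mono R p ∈ (arrowIdeal R V).asIdeal ^ k := by
  induction k with
  | zero => intro p _; simp [Submodule.pow_zero, Ideal.one_eq_top]
  | succ k ih =>
    rintro ⟨a, b, p⟩ hp
    cases p with
    | nil => simp [QPath.length] at hp
    | cons p e =>
      rename_i c
      have : mono R (⟨a, b, p.cons e⟩ : QPath V) = mono R ⟨a, c, p⟩ * mono R (QPath.arrow e) :=
        (mono_mul_mono_comp p e.toPath).symm
      rw [this, Submodule.pow_succ]
      refine Ideal.mul_mem_mul (ih _ (by simpa [QPath.length] using hp)) ?_
      exact TwoSidedIdeal.mem_asIdeal.2 (TwoSidedIdeal.subset_span ⟨_, _, e, rfl⟩)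

/-- The powers of the arrow ideal are spanned by paths. -/
theorem mem_arrowIdeal_pow {k : ℕ} {x : PathAlgebra R V} :
    x ∈ (arrowIdeal R V).asIdeal ^ k ↔ x ∈ pathSpan R {p | k ≤ p.length} := by
  constructor
  · intro hx
    induction k generalizing x with
    | zero => exact mem_pathSpan.2 fun _ _ => Nat.zero_le _
    | succ k ih =>
      rw [Submodule.pow_succ] at hx
      induction hx using Submodule.mul_induction_on' with
      | mem_mul_mem y hy z hz =>
        exact mul_mem_pathSpan_length (ih hy) (mem_arrowIdeal (TwoSidedIdeal.mem_asIdeal.1 hz))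
      | add y _ z _ hy hz => exact add_mem hy hz
  · intro hx
    induction hx using Submodule.span_induction with
    | mem x hx => obtain ⟨p, hp, rfl⟩ := hx; exact mono_mem_arrowIdeal_pow k p hp
    | zero => exact zero_mem _
    | add y z _ _ hy hz => exact add_mem hy hz
    | smul r y _ hy => rw [Algebra.smul_def]; exact Ideal.mul_mem_left _ _ hy

/-- A longer path begins with one of length exactly `k`. This is why equations for the paths of
length `m` alone can express `J^m ⊆ I`. -/
theorem arrowIdeal_pow_le_iff {k : ℕ} {I : TwoSidedIdeal (PathAlgebra R V)} :
    (arrowIdeal R V).asIdeal ^ k ≤ I.asIdeal ↔ ∀ p : QPath V, p.length = k → mono R p ∈ I := by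
  constructor
  · intro h p hp
    exact TwoSidedIdeal.mem_asIdeal.1 (h (mono_mem_arrowIdeal_pow k p hp.ge))
  · intro h x hx
    refine TwoSidedIdeal.mem_asIdeal.2 ?_
    refine (Submodule.span_le (p := I.toPathSubmodule)).2 ?_ (mem_arrowIdeal_pow.1 hx)
    rintro _ ⟨⟨a, b, p⟩, hp, rfl⟩
    obtain ⟨c, r, s, rfl, hr⟩ := p.exists_eq_comp_length_eq k hp
    rw [← mono_mul_mono_comp]
    exact I.mul_mem_right _ _ (h _ hr)

end PathAlgebra

namespace PathAlgebra

variable {R : Type*} [CommRing R] {V : Type u} [Quiver.{w + 1} V]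

open Quiver

/-! ### The elements `g_t` and their tails. -/

section Generators

variable (lt : QPath V → QPath V → Prop) (T : Set (QPath V)) (c : Coord lt T → R) (t : T)

/-- The linear combination `∑ c_{t,n} n` of normal paths. -/
def tail : PathAlgebra R V := ∑ᶠ n : normalPathsBelow lt T t, c ⟨t, n⟩ • mono R n.1

/-- The element `g_t = t - ∑ c_{t,n} n`. -/
def gen : PathAlgebra R V := mono R t.1 - tail lt T c t

variable {lt T}

theorem tail_mem : tail lt T c t ∈ pathSpan R (normalPathsBelow lt T t) := by
  unfold tail
  exact finsum_induction (· ∈ pathSpan R (normalPathsBelow lt T t)) (zero_mem _)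
    (fun _ _ => add_mem) fun n => Submodule.smul_mem _ _ (mono_mem_pathSpan n.2)

instance [Finite (normalPaths T)] : Finite (normalPathsBelow lt T t) :=
  Set.Finite.subset (Set.toFinite (normalPaths T)) fun _ h => h.1

/-- Finiteness matters here: a `finsum` with infinite support has the default value `0`, and the
coordinates could not be recovered. -/
theorem coeff_tail [Finite (normalPaths T)] (n : normalPathsBelow lt T t) :
    coeff (tail lt T c t) n.1 = c ⟨t, n⟩ := by
  rw [← coeffHom_apply, tail]
  refine ((coeffHom R V n.1).toAddMonoidHom.map_finsum (Set.toFinite _)).trans ?_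
  rw [finsum_eq_single _ n]
  · simp
  · intro n' hn
    simp [coeff_mono_of_ne (fun h => hn (Subtype.ext h))]

theorem coeff_gen_self (hlt : IsAdmissibleOrder lt) : coeff (gen lt T c t) t.1 = 1 := by
  have : coeff (tail lt T c t) t.1 = 0 := by
    by_contra h
    exact hlt.irrefl _ (mem_pathSpan.1 (tail_mem c t) _ h).2.2
  simp [gen, this]

theorem isTip_gen [Nontrivial R] (hlt : IsAdmissibleOrder lt) : IsTip lt (gen lt T c t) t.1 := by
  refine ⟨by simp [coeff_gen_self c t hlt], fun q hq => ?_⟩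
  by_cases h : t.1 = q
  · exact .inl h.symm
  · rw [gen, coeff_sub, coeff_mono_of_ne h, zero_sub, neg_ne_zero] at hq
    exact .inr (mem_pathSpan.1 (tail_mem c t) _ hq).2.2

theorem tail_mem_lt : tail lt T c t ∈ pathSpan R {q | lt q t.1} :=
  pathSpan_mono (fun _ h => h.2.2) (tail_mem c t)

theorem tail_mem_normal : tail lt T c t ∈ pathSpan R (normalPaths T) :=
  pathSpan_mono (fun _ h => h.1) (tail_mem c t)

theorem tail_mem_parallel : tail lt T c t ∈ pathSpan R {q | q.src = t.1.src ∧ q.tgt = t.1.tgt} :=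
  pathSpan_mono (fun _ h => h.2.1) (tail_mem c t)

variable [Fintype V]

/-- All paths in `g_t` are parallel to `t`. Hence `g_t` itself has the form `r g_t s` with trivial
`r` and `s`, which brings it under the definition of `relSpan`. -/
theorem mono_vertex_mul_gen_mul :
    mono R ⟨t.1.src, t.1.src, Path.nil⟩ * gen lt T c t * mono R ⟨t.1.tgt, t.1.tgt, Path.nil⟩
      = gen lt T c t :=
  mono_vertex_mul_mul_mono_vertex
    (sub_mem (mono_mem_pathSpan ⟨rfl, rfl⟩) (tail_mem_parallel c t))

end Generators

/-! ### The ideal of a point, filtered by the leading paths `r t s`. -/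

section Sandwich

variable {lt : QPath V → QPath V → Prop} [Fintype V]

theorem mono_mul_mem_lower (hlt : IsAdmissibleOrder lt) {a b c : V} (r : Path a b) {p : Path b c}
    {x : PathAlgebra R V} (hx : x ∈ pathSpan R {q | lt q ⟨b, c, p⟩}) :
    mono R ⟨a, b, r⟩ * x ∈ pathSpan R {q | lt q ⟨a, c, r.comp p⟩} :=
  mono_mul_mem_pathSpan r (fun _ q hq => hlt.mul_left r p q hq) hx

theorem mul_mono_mem_lower (hlt : IsAdmissibleOrder lt) {a b c : V} (s : Path b c) {p : Path a b}
    {x : PathAlgebra R V} (hx : x ∈ pathSpan R {q | lt q ⟨a, b, p⟩}) :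
    x * mono R ⟨b, c, s⟩ ∈ pathSpan R {q | lt q ⟨a, c, p.comp s⟩} :=
  mul_mono_mem_pathSpan s (fun _ q hq => hlt.mul_right p q s hq) hx

variable (lt) (T : Set (QPath V)) (c : Coord lt T → R)

/-- The span of the elements `r g_t s` for which the path `r t s` belongs to `S`. -/
def relSpan (S : Set (QPath V)) : Submodule R (PathAlgebra R V) :=
  Submodule.span R {x | ∃ (t : T) (a b : V) (r : Path a t.1.src) (s : Path t.1.tgt b),
    ⟨a, b, (r.comp t.1.path).comp s⟩ ∈ S ∧
    x = mono R ⟨a, t.1.src, r⟩ * gen lt T c t * mono R ⟨t.1.tgt, b, s⟩}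

variable {lt T}

theorem sandwich_mem_relSpan {S : Set (QPath V)} (t : T) {a b : V} (r : Path a t.1.src)
    (s : Path t.1.tgt b) (h : ⟨a, b, (r.comp t.1.path).comp s⟩ ∈ S) :
    mono R ⟨a, t.1.src, r⟩ * gen lt T c t * mono R ⟨t.1.tgt, b, s⟩ ∈ relSpan lt T c S :=
  Submodule.subset_span ⟨t, a, b, r, s, h, rfl⟩

theorem relSpan_mono {S S' : Set (QPath V)} (h : S ⊆ S') :
    relSpan lt T c S ≤ relSpan lt T c S' :=
  Submodule.span_mono fun _ ⟨t, a, b, r, s, hS, e⟩ => ⟨t, a, b, r, s, h hS, e⟩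

theorem mono_mul_mem_relSpan {S S' : Set (QPath V)} {a b : V} (r : Path a b)
    (h : ∀ (d : V) (q : Path b d), ⟨b, d, q⟩ ∈ S → ⟨a, d, r.comp q⟩ ∈ S')
    {x : PathAlgebra R V} (hx : x ∈ relSpan lt T c S) :
    mono R ⟨a, b, r⟩ * x ∈ relSpan lt T c S' := by
  induction hx using Submodule.span_induction with
  | mem x hx =>
    obtain ⟨t, b', d, r', s, hS, rfl⟩ := hx
    rw [← mul_assoc, ← mul_assoc]
    by_cases hb : b = b'
    · subst hb
      rw [mono_mul_mono_comp]
      refine sandwich_mem_relSpan c t _ s ?_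
      have := h _ _ hS
      rwa [← Path.comp_assoc, ← Path.comp_assoc] at this
    · rw [mono_mul_mono_of_ne hb, zero_mul, zero_mul]
      exact zero_mem _
  | zero => rw [mul_zero]; exact zero_mem _
  | add x y _ _ hx hy => rw [mul_add]; exact add_mem hx hy
  | smul k x _ hx => rw [mul_smul_comm]; exact Submodule.smul_mem _ _ hx

theorem mul_mono_mem_relSpan {S S' : Set (QPath V)} {b d : V} (s : Path b d)
    (h : ∀ (a : V) (q : Path a b), ⟨a, b, q⟩ ∈ S → ⟨a, d, q.comp s⟩ ∈ S')
    {x : PathAlgebra R V} (hx : x ∈ relSpan lt T c S) :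
    x * mono R ⟨b, d, s⟩ ∈ relSpan lt T c S' := by
  induction hx using Submodule.span_induction with
  | mem x hx =>
    obtain ⟨t, a, b', r, s', hS, rfl⟩ := hx
    rw [mul_assoc]
    by_cases hb : b' = b
    · subst hb
      rw [mono_mul_mono_comp]
      refine sandwich_mem_relSpan c t r _ ?_
      have := h _ _ hS
      rwa [Path.comp_assoc] at this
    · rw [mono_mul_mono_of_ne hb, mul_zero]
      exact zero_mem _
  | zero => rw [zero_mul]; exact zero_mem _
  | add x y _ _ hx hy => rw [add_mul]; exact add_mem hx hy
  | smul k x _ hx => rw [smul_mul_assoc]; exact Submodule.smul_mem _ _ hx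

theorem mono_mul_mem_relSpan_lower (hlt : IsAdmissibleOrder lt) {a b d : V} (r : Path a b)
    {p : Path b d} {x : PathAlgebra R V} (hx : x ∈ relSpan lt T c {q | lt q ⟨b, d, p⟩}) :
    mono R ⟨a, b, r⟩ * x ∈ relSpan lt T c {q | lt q ⟨a, d, r.comp p⟩} :=
  mono_mul_mem_relSpan c r (fun _ q hq => hlt.mul_left r p q hq) hx

theorem mul_mono_mem_relSpan_lower (hlt : IsAdmissibleOrder lt) {a b d : V} (s : Path b d)
    {p : Path a b} {x : PathAlgebra R V} (hx : x ∈ relSpan lt T c {q | lt q ⟨a, b, p⟩}) :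
    x * mono R ⟨b, d, s⟩ ∈ relSpan lt T c {q | lt q ⟨a, d, p.comp s⟩} :=
  mul_mono_mem_relSpan c s (fun _ q hq => hlt.mul_right p q s hq) hx

theorem gen_mul_mem_relSpan (t : T) {S : Set (QPath V)} {W : Set (QPath V)}
    (h : ∀ (d : V) (q : Path t.1.tgt d), ⟨_, d, q⟩ ∈ S → ⟨_, d, t.1.path.comp q⟩ ∈ W)
    {x : PathAlgebra R V} (hx : x ∈ pathSpan R S) : gen lt T c t * x ∈ relSpan lt T c W := by
  induction hx using Submodule.span_induction with
  | mem x hx =>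
    obtain ⟨⟨b, d, q⟩, hq, rfl⟩ := hx
    rw [← mono_vertex_mul_gen_mul c t, mul_assoc]
    by_cases hb : t.1.tgt = b
    · subst hb
      rw [mono_mul_mono_comp]
      refine sandwich_mem_relSpan c t _ _ ?_
      simpa using h d q hq
    · rw [mono_mul_mono_of_ne hb, mul_zero]
      exact zero_mem _
  | zero => rw [mul_zero]; exact zero_mem _
  | add x y _ _ hx hy => rw [mul_add]; exact add_mem hx hy
  | smul k x _ hx => rw [mul_smul_comm]; exact Submodule.smul_mem _ _ hx

theorem mul_gen_mem_relSpan (t : T) {S : Set (QPath V)} {W : Set (QPath V)}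
    (h : ∀ (a : V) (q : Path a t.1.src), ⟨a, _, q⟩ ∈ S → ⟨a, _, q.comp t.1.path⟩ ∈ W)
    {x : PathAlgebra R V} (hx : x ∈ pathSpan R S) : x * gen lt T c t ∈ relSpan lt T c W := by
  induction hx using Submodule.span_induction with
  | mem x hx =>
    obtain ⟨⟨a, b, q⟩, hq, rfl⟩ := hx
    rw [← mono_vertex_mul_gen_mul c t, ← mul_assoc, ← mul_assoc]
    by_cases hb : b = t.1.src
    · subst hb
      rw [mono_mul_mono_comp]
      refine sandwich_mem_relSpan c t _ _ ?_
      simpa using h a q hq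
    · rw [mono_mul_mono_of_ne hb, zero_mul, zero_mul]
      exact zero_mem _
  | zero => rw [zero_mul]; exact zero_mem _
  | add x y _ _ hx hy => rw [add_mul]; exact add_mem hx hy
  | smul k x _ hx => rw [smul_mul_assoc]; exact Submodule.smul_mem _ _ hx

/-- Without a bound on the leading paths the span is already a two-sided ideal. The diamond lemma is
about lowering the bound. -/
theorem mem_idealOfPoint_iff {x : PathAlgebra R V} :
    x ∈ idealOfPoint lt T c ↔ x ∈ relSpan lt T c Set.univ := by
  constructor
  · refine fun h => span_subset_of_mono_mul_mem ?_ ?_ ?_ h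
    · rintro _ ⟨t, rfl⟩
      have := sandwich_mem_relSpan c t Path.nil Path.nil (S := Set.univ) trivial
      rwa [mono_vertex_mul_gen_mul c t] at this
    · rintro ⟨a, b, r⟩ x hx
      exact mono_mul_mem_relSpan c (S' := Set.univ) r (fun _ _ _ => trivial) hx
    · rintro ⟨a, b, r⟩ x hx
      exact mul_mono_mem_relSpan c (S' := Set.univ) r (fun _ _ _ => trivial) hx
  · intro h
    refine (Submodule.span_le (p := (idealOfPoint lt T c).toPathSubmodule)).2 ?_ h
    rintro _ ⟨t, a, b, r, s, -, rfl⟩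
    exact TwoSidedIdeal.mul_mem_right _ _ _ (TwoSidedIdeal.mul_mem_left _ _ _
      (TwoSidedIdeal.subset_span ⟨t, rfl⟩))

theorem gen_mem_idealOfPoint (t : T) : gen lt T c t ∈ idealOfPoint lt T c :=
  TwoSidedIdeal.subset_span ⟨t, rfl⟩

/-- The element `r g_t s` is `r t s` minus smaller paths. -/
theorem sandwich_gen_sub_mem (hlt : IsAdmissibleOrder lt) (t : T) {a b : V} (r : Path a t.1.src)
    (s : Path t.1.tgt b) :
    mono R ⟨a, b, (r.comp t.1.path).comp s⟩ -
      mono R ⟨a, t.1.src, r⟩ * gen lt T c t * mono R ⟨t.1.tgt, b, s⟩ ∈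
      pathSpan R {q | lt q ⟨a, b, (r.comp t.1.path).comp s⟩} := by
  have h := mul_mono_mem_lower hlt s (mono_mul_mem_lower hlt r (tail_mem_lt c t))
  rw [← mono_mul_mono_comp, ← mono_mul_mono_comp, gen, mul_sub, sub_mul, sub_sub_cancel]
  exact h

end Sandwich

/-! ### The diamond lemma. -/

section Diamond

variable {lt : QPath V → QPath V → Prop} [Fintype V] {T : Set (QPath V)}

/-- The S-elements of all overlaps of tips are combinations of elements `r g_t s` with `r t s`
smaller than the overlap. -/
def OverlapsResolve (c : Coord lt T → R) : Prop :=
  ∀ (t t' : T) (a d : V) (m : Path t.1.tgt d) (n : Path a t'.1.src),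
    (⟨t.1.src, d, t.1.path.comp m⟩ : QPath V) = ⟨a, t'.1.tgt, n.comp t'.1.path⟩ →
    1 ≤ n.length → 1 ≤ m.length → m.length < t'.1.length →
    gen lt T c t * mono R ⟨t.1.tgt, d, m⟩ - mono R ⟨a, t'.1.src, n⟩ * gen lt T c t' ∈
      relSpan lt T c {q | lt q ⟨t.1.src, d, t.1.path.comp m⟩}

variable {c : Coord lt T → R}

/-- Tips that do not overlap cause no obstruction. Writing `t = g + τ` and `t' = g' + τ'` with tails
`τ`, `τ'`, one gets `g v t' - t v g' = g v τ' - τ v g'`, and both terms on the right have smaller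
leading paths. -/
theorem sandwich_sub_sandwich_mem_disjoint (hlt : IsAdmissibleOrder lt) (t t' : T) {a b : V}
    (r : Path a t.1.src) (v : Path t.1.tgt t'.1.src) (s' : Path t'.1.tgt b) :
    mono R ⟨a, t.1.src, r⟩ * gen lt T c t *
        mono R ⟨t.1.tgt, b, v.comp (t'.1.path.comp s')⟩ -
      mono R ⟨a, t'.1.src, r.comp (t.1.path.comp v)⟩ * gen lt T c t' * mono R ⟨t'.1.tgt, b, s'⟩ ∈
      relSpan lt T c {q | lt q ⟨a, b, (r.comp t.1.path).comp (v.comp (t'.1.path.comp s'))⟩} := by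
  have h1 := mul_mono_mem_relSpan_lower c hlt s' <| mono_mul_mem_relSpan_lower c hlt r <|
    gen_mul_mem_relSpan c t (W := {q | lt q ⟨_, _, t.1.path.comp (v.comp t'.1.path)⟩})
      (fun d q hq => hlt.mul_left t.1.path _ q hq) (mono_mul_mem_lower hlt v (tail_mem_lt c t'))
  have h2 := mul_mono_mem_relSpan_lower c hlt s' <| mono_mul_mem_relSpan_lower c hlt r <|
    mul_gen_mem_relSpan c t' (W := {q | lt q ⟨_, _, (t.1.path.comp v).comp t'.1.path⟩})
      (fun d q hq => hlt.mul_right _ q t'.1.path hq) (mul_mono_mem_lower hlt v (tail_mem_lt c t))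
  simp only [Path.comp_assoc] at h1 h2 ⊢
  convert sub_mem h1 h2 using 1
  simp only [← mono_mul_mono_comp]
  have e : mono R t.1 = gen lt T c t + tail lt T c t := by simp [gen]
  have e' : mono R t'.1 = gen lt T c t' + tail lt T c t' := by simp [gen]
  change mono R ⟨a, t.1.src, r⟩ * gen lt T c t *
        (mono R ⟨_, _, v⟩ * (mono R t'.1 * mono R ⟨_, _, s'⟩)) -
      mono R ⟨a, _, r⟩ * (mono R t.1 * mono R ⟨_, _, v⟩) * gen lt T c t' *
        mono R ⟨t'.1.tgt, b, s'⟩ = _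
  rw [e, e']
  noncomm_ring

theorem sandwich_sub_sandwich_mem_of_length_le (hlt : IsAdmissibleOrder lt) (hT : TipReduced T)
    (hov : OverlapsResolve c) (t t' : T) {a b : V} (r : Path a t.1.src) (s : Path t.1.tgt b)
    (r' : Path a t'.1.src) (s' : Path t'.1.tgt b)
    (h : (r.comp t.1.path).comp s = (r'.comp t'.1.path).comp s') (hl : r.length ≤ r'.length) :
    mono R ⟨a, t.1.src, r⟩ * gen lt T c t * mono R ⟨t.1.tgt, b, s⟩ -
      mono R ⟨a, t'.1.src, r'⟩ * gen lt T c t' * mono R ⟨t'.1.tgt, b, s'⟩ ∈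
      relSpan lt T c {q | lt q ⟨a, b, (r.comp t.1.path).comp s⟩} := by
  have hsub : ∀ t t' : T, t.1.IsSubpath t'.1 → t = t' := fun t t' h' => by
    by_contra hne
    exact hT _ t.2 _ t'.2 (fun e => hne (Subtype.ext e)) h'
  rw [Path.comp_assoc, Path.comp_assoc] at h
  obtain ⟨n, rfl, hn⟩ := Path.exists_comp_of_comp_eq_comp _ _ _ _ h hl
  -- Here `n` is the part of `r'` beyond `r`. If `t` fits into `n`, the two tips are disjoint.
  rcases le_or_gt t.1.path.length n.length with hl2 | hl2
  · obtain ⟨v, rfl, rfl⟩ := Path.exists_comp_of_comp_eq_comp _ _ _ _ hn hl2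
    exact sandwich_sub_sandwich_mem_disjoint hlt t t' r v s'
  · obtain ⟨v, hv, hv'⟩ := Path.exists_comp_of_comp_eq_comp _ _ _ _ hn.symm hl2.le
    have hlen := congrArg Path.length hv
    rw [Path.length_comp] at hlen
    -- Now `v` is the part of `t` after the start of `t'`. If `t'` fits into `v`, it is a subpath of
    -- `t`, so the tips and their positions coincide.
    rcases le_or_gt t'.1.path.length v.length with hl3 | hl3
    · obtain ⟨z, rfl, rfl⟩ := Path.exists_comp_of_comp_eq_comp _ _ _ _ hv' hl3
      have : t'.1.IsSubpath t.1 := ⟨_, _, n, z, by rw [Path.comp_assoc, ← hv]⟩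
      obtain rfl := hsub _ _ this
      rw [Path.length_comp] at hlen
      rw [Path.eq_nil_of_length_zero n (by omega), Path.eq_nil_of_length_zero z (by omega)]
      simp
    · obtain ⟨m, hm, rfl⟩ := Path.exists_comp_of_comp_eq_comp _ _ _ _ hv'.symm hl3.le
      have hlen' := congrArg Path.length hm
      rw [Path.length_comp] at hlen'
      -- The remaining case is a proper overlap `t m = n t'`. A trivial `n` would make `t` an
      -- initial subpath of `t'`, hence equal to it, against the length bound on `v`.
      have hn1 : 1 ≤ n.length := by
        by_contra hn0
        have hn0 : n.length = 0 := by omega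
        have : t.1.IsSubpath t'.1 := by
          have h1 : t'.1.IsSubpath ⟨_, _, n.comp t'.1.path⟩ := ⟨_, _, n, Path.nil, rfl⟩
          rw [h1.eq_of_length_le (by simp [QPath.length, hn0])]
          exact ⟨_, _, Path.nil, m, by rw [Path.nil_comp, hv, hm, Path.comp_assoc]⟩
        obtain rfl := hsub _ _ this
        omega
      have key := hov t t' _ _ m n (by rw [hv, hm, Path.comp_assoc]) hn1 (by omega)
        (by unfold QPath.length; omega)
      have := mul_mono_mem_relSpan_lower c hlt s' (mono_mul_mem_relSpan_lower c hlt r key)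
      simp only [Path.comp_assoc] at this ⊢
      convert this using 1
      simp only [← mono_mul_mono_comp]
      noncomm_ring

theorem sandwich_sub_sandwich_mem (hlt : IsAdmissibleOrder lt) (hT : TipReduced T)
    (hov : OverlapsResolve c) (t t' : T) {a b : V} (r : Path a t.1.src) (s : Path t.1.tgt b)
    (r' : Path a t'.1.src) (s' : Path t'.1.tgt b)
    (h : (r.comp t.1.path).comp s = (r'.comp t'.1.path).comp s') :
    mono R ⟨a, t.1.src, r⟩ * gen lt T c t * mono R ⟨t.1.tgt, b, s⟩ -
      mono R ⟨a, t'.1.src, r'⟩ * gen lt T c t' * mono R ⟨t'.1.tgt, b, s'⟩ ∈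
      relSpan lt T c {q | lt q ⟨a, b, (r.comp t.1.path).comp s⟩} := by
  rcases le_total r.length r'.length with hl | hl
  · exact sandwich_sub_sandwich_mem_of_length_le hlt hT hov t t' r s r' s' h hl
  · have := neg_mem (sandwich_sub_sandwich_mem_of_length_le hlt hT hov t' t r' s' r s h.symm hl)
    rwa [neg_sub, ← h] at this

/-- Down-closure is needed because `r g_t s` also involves paths below `r t s`. -/
theorem relSpan_le_pathSpan (hlt : IsAdmissibleOrder lt) (S : Set (QPath V))
    (hS : ∀ p ∈ S, ∀ q, lt q p → q ∈ S) : relSpan lt T c S ≤ pathSpan R S := by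
  refine Submodule.span_le.2 ?_
  rintro _ ⟨t, a, b, r, s, h, rfl⟩
  have h1 := sandwich_gen_sub_mem c hlt t r s
  have h2 := pathSpan_mono (R := R) (fun q hq => hS _ h q hq) h1
  simpa using sub_mem (mono_mem_pathSpan (R := R) h) h2

/-- A combination uses finitely many `r g_t s`, so one of their leading paths is largest. This
supplies the next bound in a well-founded descent; `¬ lt p q` stands for `q ≤ p`. -/
theorem exists_mem_relSpan_le (hlt : IsAdmissibleOrder lt) {S : Set (QPath V)}
    {x : PathAlgebra R V} (hx : x ∈ relSpan lt T c S) :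
    x = 0 ∨ ∃ p ∈ S, x ∈ relSpan lt T c {q | ¬ lt p q} := by
  induction hx using Submodule.span_induction with
  | mem x hx =>
    obtain ⟨t, a, b, r, s, h, rfl⟩ := hx
    exact .inr ⟨_, h, sandwich_mem_relSpan c t r s (hlt.irrefl _)⟩
  | zero => exact .inl rfl
  | add x y _ _ hx hy =>
    rcases hx with rfl | ⟨p, hp, hx⟩
    · rwa [zero_add]
    rcases hy with rfl | ⟨q, hq, hy⟩
    · rw [add_zero]
      exact .inr ⟨p, hp, hx⟩
    rcases hlt.trichotomous p q with h | rfl | h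
    · exact .inr ⟨q, hq, add_mem (relSpan_mono c (fun z (hz : ¬ lt _ z) hz' => hz (hlt.trans h hz')) hx) hy⟩
    · exact .inr ⟨p, hp, add_mem hx hy⟩
    · exact .inr ⟨p, hp, add_mem hx (relSpan_mono c (fun z (hz : ¬ lt _ z) hz' => hz (hlt.trans h hz')) hy)⟩
  | smul k x _ hx =>
    rcases hx with rfl | ⟨p, hp, hx⟩
    · exact .inl (smul_zero _)
    · exact .inr ⟨p, hp, Submodule.smul_mem _ _ hx⟩

/-- Modulo lower terms, all `r g_t s` with leading path `p` agree with one fixed `y`, and each has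
coefficient `1` at `p`. Their total contribution is therefore `coeff x p • y`, which vanishes. -/
theorem mem_relSpan_lt_of_coeff_eq_zero (hlt : IsAdmissibleOrder lt) (hT : TipReduced T)
    (hov : OverlapsResolve c) {p : QPath V} {x : PathAlgebra R V}
    (hx : x ∈ relSpan lt T c {q | ¬ lt p q}) (h0 : coeff x p = 0) :
    x ∈ relSpan lt T c {q | lt q p} := by
  obtain ⟨y, hy⟩ : ∃ y, ∀ (t : T) (a b : V) (r : Path a t.1.src) (s : Path t.1.tgt b),
      ⟨a, b, (r.comp t.1.path).comp s⟩ = p →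
      mono R ⟨a, t.1.src, r⟩ * gen lt T c t * mono R ⟨t.1.tgt, b, s⟩ - y ∈
        relSpan lt T c {q | lt q p} := by
    by_cases hex : ∃ (t : T) (a b : V) (r : Path a t.1.src) (s : Path t.1.tgt b),
      ⟨a, b, (r.comp t.1.path).comp s⟩ = p
    · obtain ⟨t, a, b, r, s, rfl⟩ := hex
      refine ⟨mono R ⟨a, t.1.src, r⟩ * gen lt T c t * mono R ⟨t.1.tgt, b, s⟩, ?_⟩
      intro t' a' b' r' s' he
      obtain rfl := congrArg QPath.src he
      obtain rfl := congrArg QPath.tgt he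
      simp only [QPath.mk.injEq, heq_eq_eq, true_and] at he
      have := sandwich_sub_sandwich_mem hlt hT hov t' t r' s' r s he
      rwa [he] at this
    · exact ⟨0, fun t a b r s he => (hex ⟨t, a, b, r, s, he⟩).elim⟩
  -- This form is linear in `x`, so it can be proved on generators; the vanishing of the coefficient
  -- is not inherited by the summands.
  have key : x - coeff x p • y ∈ relSpan lt T c {q | lt q p} := by
    clear h0
    induction hx using Submodule.span_induction with
    | mem x hx =>
      obtain ⟨t, a, b, r, s, h, rfl⟩ := hx
      have h1 := sandwich_gen_sub_mem c hlt t r s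
      set z := mono R ⟨a, t.1.src, r⟩ * gen lt T c t * mono R ⟨t.1.tgt, b, s⟩ with hz
      by_cases he : ⟨a, b, (r.comp t.1.path).comp s⟩ = p
      · have h2 : coeff z p = 1 := by
          rw [he] at h1
          by_contra h3
          refine hlt.irrefl p (mem_pathSpan.1 h1 p ?_)
          rw [coeff_sub, coeff_mono_self]
          exact sub_ne_zero.2 (Ne.symm h3)
        rw [h2, one_smul]
        exact hy t a b r s he
      · have hlt' : lt ⟨a, b, (r.comp t.1.path).comp s⟩ p := by
          rcases hlt.trichotomous ⟨a, b, (r.comp t.1.path).comp s⟩ p with h' | h' | h'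
          · exact h'
          · exact (he h').elim
          · exact (h h').elim
        have h2 : coeff z p = 0 := by
          by_contra h3
          refine hlt.irrefl p (hlt.trans (mem_pathSpan.1 h1 p ?_) hlt')
          rw [coeff_sub, coeff_mono_of_ne he, zero_sub]
          exact neg_ne_zero.2 h3
        rw [h2, zero_smul, sub_zero]
        exact sandwich_mem_relSpan c t r s hlt'
    | zero => simp
    | add x z _ _ hx hz =>
      rw [coeff_add, add_smul, add_sub_add_comm]
      exact add_mem hx hz
    | smul k x _ hx =>
      rw [coeff_smul, mul_smul, ← smul_sub]
      exact Submodule.smul_mem _ _ hx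
  simpa [h0] using key

omit [Fintype V] in
theorem mem_normalPaths_iff {p : QPath V} :
    p ∉ normalPaths T ↔ ∃ t ∈ T, t.IsSubpath p := by
  simp [normalPaths]

/-- The diamond lemma: if all overlaps resolve, then the ideal contains no nonzero combination of
normal paths. -/
theorem eq_zero_of_mem_idealOfPoint (hlt : IsAdmissibleOrder lt) (hT : TipReduced T)
    (hov : OverlapsResolve c) {x : PathAlgebra R V} (hx : x ∈ idealOfPoint lt T c)
    (hN : x ∈ pathSpan R (normalPaths T)) : x = 0 := by
  -- The bound `p` can always be lowered. If `p` is normal, no `r t s` equals it; otherwise `x`,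
  -- being a combination of normal paths, has coefficient `0` at `p`.
  have main : ∀ p, ∀ x ∈ relSpan lt T c {q | ¬ lt p q}, x ∈ pathSpan R (normalPaths T) →
      x = 0 := by
    intro p
    induction p using hlt.wf.induction with
    | _ p ih =>
      intro x hx hN
      have hx' : x ∈ relSpan lt T c {q | lt q p} := by
        by_cases hp : p ∈ normalPaths T
        · refine relSpan_mono c ?_ (?_ : x ∈ relSpan lt T c ({q | ¬ lt p q} \ {p}))
          · rintro q ⟨hq, hne⟩
            rcases hlt.trichotomous q p with h | h | h
            · exact h
            · exact (hne h).elim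
            · exact (hq h).elim
          · refine Submodule.span_mono ?_ hx
            rintro _ ⟨t, a, b, r, s, h, rfl⟩
            refine ⟨t, a, b, r, s, ⟨h, ?_⟩, rfl⟩
            rintro rfl
            exact hp t.1 t.2 ⟨a, b, r, s, rfl⟩
        · refine mem_relSpan_lt_of_coeff_eq_zero hlt hT hov hx ?_
          by_contra h
          exact hp (mem_pathSpan.1 hN p h)
      rcases exists_mem_relSpan_le hlt hx' with h | ⟨q, hq, hx''⟩
      · exact h
      · exact ih q hq x hx'' hN
  rcases exists_mem_relSpan_le hlt ((mem_idealOfPoint_iff c).1 hx) with h | ⟨q, -, hx'⟩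
  · exact h
  · exact main q x hx' hN

end Diamond

end PathAlgebra

namespace PathAlgebra

variable {R : Type*} [CommRing R] {V : Type u} [Quiver.{w + 1} V]

open Quiver

/-! ### Simple and complete reductions by the `g_t`. -/

section Reductions

variable {lt : QPath V → QPath V → Prop} [Fintype V] {T : Set (QPath V)} {c : Coord lt T → R}
  [Nontrivial R]

/-- Since `g_t` is monic, the scalar `β` is `1`: a reduction step only subtracts an element of the
ideal, even over a ring that is not a field. -/
theorem simpleReduction_iff (hlt : IsAdmissibleOrder lt) {x y : PathAlgebra R V} :
    SimpleReduction lt (genSet lt T c) x y ↔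
      ∃ (t : T) (a b : V) (r : Path a t.1.src) (s : Path t.1.tgt b),
        coeff x ⟨a, b, (r.comp t.1.path).comp s⟩ ≠ 0 ∧
        y = x - coeff x ⟨a, b, (r.comp t.1.path).comp s⟩ •
          (mono R ⟨a, t.1.src, r⟩ * gen lt T c t * mono R ⟨t.1.tgt, b, s⟩) := by
  constructor
  · rintro ⟨_, ⟨t, rfl⟩, t', ht', a, b, r, s, h, rfl⟩
    obtain rfl := ht'.unique hlt (isTip_gen c t hlt)
    refine ⟨t, a, b, r, s, h, ?_⟩
    change coeff (gen lt T c t) t.1 • x - _ = _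
    rw [coeff_gen_self c t hlt, one_smul]
    rfl
  · rintro ⟨t, a, b, r, s, h, rfl⟩
    refine ⟨gen lt T c t, ⟨t, rfl⟩, t.1, isTip_gen c t hlt, a, b, r, s, h, ?_⟩
    rw [coeff_gen_self c t hlt, one_smul]

theorem forall_not_simpleReduction_iff (hlt : IsAdmissibleOrder lt) {x : PathAlgebra R V} :
    (∀ y, ¬ SimpleReduction lt (genSet lt T c) x y) ↔ x ∈ pathSpan R (normalPaths T) := by
  rw [mem_pathSpan]
  constructor
  · rintro h p hp t ht ⟨a, b, r, s, rfl⟩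
    exact h _ ((simpleReduction_iff hlt).2 ⟨⟨t, ht⟩, a, b, r, s, hp, rfl⟩)
  · intro h y hy
    obtain ⟨t, a, b, r, s, hp, -⟩ := (simpleReduction_iff hlt).1 hy
    exact h _ hp t.1 t.2 ⟨a, b, r, s, rfl⟩

theorem completeReduction_iff (hlt : IsAdmissibleOrder lt) {x y : PathAlgebra R V} :
    CompleteReduction lt (genSet lt T c) x y ↔
      Relation.ReflTransGen (SimpleReduction lt (genSet lt T c)) x y ∧
        y ∈ pathSpan R (normalPaths T) := by
  rw [CompleteReduction, forall_not_simpleReduction_iff hlt]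
  refine and_congr_right fun _ => ⟨?_, .inr⟩
  rintro (rfl | h)
  · exact zero_mem _
  · exact h

/-- Reducing never leaves a down-closed set of paths, so every subtracted `r g_t s` has its leading
path in `S`. The bound `S` is what the diamond lemma asks for. -/
theorem sub_mem_relSpan_of_reflTransGen (hlt : IsAdmissibleOrder lt) {S : Set (QPath V)}
    (hS : ∀ p ∈ S, ∀ q, lt q p → q ∈ S) {x y : PathAlgebra R V} (hx : x ∈ pathSpan R S)
    (h : Relation.ReflTransGen (SimpleReduction lt (genSet lt T c)) x y) :
    x - y ∈ relSpan lt T c S := by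
  induction h with
  | refl => rw [sub_self]; exact zero_mem _
  | @tail y z _ h ih =>
    have hy : y ∈ pathSpan R S := by
      have := sub_mem hx (relSpan_le_pathSpan hlt S hS ih)
      rwa [sub_sub_cancel] at this
    obtain ⟨t, a, b, r, s, hp, rfl⟩ := (simpleReduction_iff hlt).1 h
    rw [sub_sub_eq_add_sub, add_sub_right_comm]
    exact add_mem ih (Submodule.smul_mem _ _
      (sandwich_mem_relSpan c t r s (mem_pathSpan.1 hy _ hp)))

/-- The summand `z` is a spectator above `p`: carrying it along lets the induction hypothesis reduce
the lower part of an element while the higher terms stay in place. -/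
theorem exists_reduction_below (hlt : IsAdmissibleOrder lt) (p : QPath V) :
    ∀ x ∈ pathSpan R {q | ¬ lt p q}, ∀ z ∈ pathSpan R {q | lt p q},
      ∃ y ∈ pathSpan R (normalPaths T), y ∈ pathSpan R {q | ¬ lt p q} ∧
        Relation.ReflTransGen (SimpleReduction lt (genSet lt T c)) (x + z) (y + z) := by
  induction p using hlt.wf.induction with
  | _ p ih =>
  have low : ∀ x ∈ pathSpan R {q | lt q p}, ∀ z ∈ pathSpan R {q | ¬ lt q p},
      ∃ y ∈ pathSpan R (normalPaths T), y ∈ pathSpan R {q | lt q p} ∧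
        Relation.ReflTransGen (SimpleReduction lt (genSet lt T c)) (x + z) (y + z) := by
    intro x hx z hz
    by_cases h0 : x = 0
    · subst h0
      exact ⟨0, zero_mem _, zero_mem _, .refl⟩
    obtain ⟨q, hq⟩ := exists_isTip hlt h0
    have hqp : lt q p := mem_pathSpan.1 hx q hq.1
    obtain ⟨y, hy, hy', h⟩ := ih q hqp x
      (mem_pathSpan.2 fun r hr hqr => by
        rcases hq.2 r hr with rfl | h
        · exact hlt.irrefl _ hqr
        · exact hlt.irrefl _ (hlt.trans hqr h))
      z (mem_pathSpan.2 fun r hr => by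
        rcases hlt.trichotomous q r with h | rfl | h
        · exact h
        · exact (mem_pathSpan.1 hz _ hr hqp).elim
        · exact (mem_pathSpan.1 hz _ hr (hlt.trans h hqp)).elim)
    refine ⟨y, hy, mem_pathSpan.2 fun r hr => ?_, h⟩
    rcases hlt.trichotomous q r with h | rfl | h
    · exact (mem_pathSpan.1 hy' r hr h).elim
    · exact hqp
    · exact hlt.trans h hqp
  intro x hx z hz
  set α := coeff x p with hα
  have hx' : x - α • mono R p ∈ pathSpan R {q | lt q p} := by
    refine mem_pathSpan.2 fun r hr => ?_
    by_cases hrp : p = r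
    · subst hrp
      simp [hα] at hr
    · rw [coeff_sub, coeff_smul, coeff_mono_of_ne hrp, mul_zero, sub_zero] at hr
      rcases hlt.trichotomous p r with h | h | h
      · exact (mem_pathSpan.1 hx r hr h).elim
      · exact (hrp h).elim
      · exact h
  have hzn : z ∈ pathSpan R {q | ¬ lt q p} :=
    pathSpan_mono (fun q hq hq' => hlt.irrefl _ (hlt.trans hq hq')) hz
  have hpn : α • mono R p ∈ pathSpan R {q | ¬ lt q p} :=
    Submodule.smul_mem _ _ (mono_mem_pathSpan (hlt.irrefl p))
  have hle : pathSpan R {q | lt q p} ≤ pathSpan R {q | ¬ lt p q} :=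
    pathSpan_mono fun q hq hq' => hlt.irrefl _ (hlt.trans hq hq')
  -- The terms below `p` are reduced first, with `α p + z` as spectator.
  obtain ⟨y, hy, hy', h⟩ := low _ hx' _ (add_mem hpn hzn)
  rw [← add_assoc, sub_add_cancel, ← add_assoc] at h
  by_cases hp : α = 0 ∨ p ∈ normalPaths T
  · refine ⟨y + α • mono R p, ?_, add_mem (hle hy')
      (Submodule.smul_mem _ _ (mono_mem_pathSpan (hlt.irrefl p))), h⟩
    rcases hp with h0 | h0
    · rwa [h0, zero_smul, add_zero]
    · exact add_mem hy (Submodule.smul_mem _ _ (mono_mem_pathSpan h0))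
  · push Not at hp
    obtain ⟨t, ht, a, b, r, s, rfl⟩ := mem_normalPaths_iff.1 hp.2
    have hc : coeff (y + α • mono R ⟨a, b, (r.comp t.path).comp s⟩ + z)
        ⟨a, b, (r.comp t.path).comp s⟩ = α := by
      have h1 : coeff y ⟨a, b, (r.comp t.path).comp s⟩ = 0 := by
        by_contra h1
        exact hlt.irrefl _ (mem_pathSpan.1 hy' _ h1)
      have h2 : coeff z ⟨a, b, (r.comp t.path).comp s⟩ = 0 := by
        by_contra h1
        exact hlt.irrefl _ (mem_pathSpan.1 hz _ h1)
      rw [coeff_add, coeff_add, h1, h2, coeff_smul, coeff_mono_self]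
      ring
    have hstep := (simpleReduction_iff (c := c) hlt).2
      ⟨⟨t, ht⟩, a, b, r, s, by rw [hc]; exact hp.1, rfl⟩
    rw [hc] at hstep
    -- Reducing at `p` replaces `α p` by terms below `p`, so the lower part is reduced once more.
    have hlow := Submodule.smul_mem _ α (sandwich_gen_sub_mem c hlt ⟨t, ht⟩ r s)
    obtain ⟨y', hy1, hy2, h'⟩ := low _ (add_mem hy' hlow) _ hzn
    refine ⟨y', hy1, hle hy2, h.trans (.head hstep ?_)⟩
    convert h' using 1
    rw [smul_sub]
    abel

/-- Every element has a complete reduction. -/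
theorem exists_completeReduction (hlt : IsAdmissibleOrder lt) (x : PathAlgebra R V) :
    ∃ y, CompleteReduction lt (genSet lt T c) x y := by
  by_cases h0 : x = 0
  · subst h0
    exact ⟨0, .refl, .inl rfl⟩
  obtain ⟨p, hp⟩ := exists_isTip hlt h0
  obtain ⟨y, hy, -, h⟩ := exists_reduction_below (c := c) hlt p x
    (mem_pathSpan.2 fun r hr hqr => by
      rcases hp.2 r hr with rfl | h
      · exact hlt.irrefl _ hqr
      · exact hlt.irrefl _ (hlt.trans hqr h)) 0 (zero_mem _)
  rw [add_zero, add_zero] at h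
  exact ⟨y, (completeReduction_iff hlt).2 ⟨h, hy⟩⟩

theorem isOverlapRelation_gen_iff (hlt : IsAdmissibleOrder lt) (t t' : T) {o : PathAlgebra R V} :
    IsOverlapRelation lt (gen lt T c t) (gen lt T c t') o ↔
      ∃ (a d : V) (m : Path t.1.tgt d) (n : Path a t'.1.src),
        (⟨t.1.src, d, t.1.path.comp m⟩ : QPath V) = ⟨a, t'.1.tgt, n.comp t'.1.path⟩ ∧
        1 ≤ n.length ∧ 1 ≤ m.length ∧ m.length < t'.1.length ∧
        o = gen lt T c t * mono R ⟨t.1.tgt, d, m⟩ - mono R ⟨a, t'.1.src, n⟩ * gen lt T c t' := by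
  constructor
  · rintro ⟨s, s', hs, hs', a, d, m, n, h1, h2, h3, h4, rfl⟩
    obtain rfl := hs.unique hlt (isTip_gen c t hlt)
    obtain rfl := hs'.unique hlt (isTip_gen c t' hlt)
    refine ⟨a, d, m, n, h1, h2, h3, h4, ?_⟩
    rw [coeff_gen_self c t hlt, coeff_gen_self c t' hlt, one_smul, one_smul]
  · rintro ⟨a, d, m, n, h1, h2, h3, h4, rfl⟩
    refine ⟨t.1, t'.1, isTip_gen c t hlt, isTip_gen c t' hlt, a, d, m, n, h1, h2, h3, h4, ?_⟩
    rw [coeff_gen_self c t hlt, coeff_gen_self c t' hlt, one_smul, one_smul]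

omit [Nontrivial R] in
-- The leading terms `t m` and `n t'` cancel, so the whole reduction of an overlap relation takes
-- place strictly below the overlap path.
theorem overlap_mem_lower (hlt : IsAdmissibleOrder lt) (t t' : T) {a d : V} {m : Path t.1.tgt d}
    {n : Path a t'.1.src}
    (h : (⟨t.1.src, d, t.1.path.comp m⟩ : QPath V) = ⟨a, t'.1.tgt, n.comp t'.1.path⟩) :
    gen lt T c t * mono R ⟨t.1.tgt, d, m⟩ - mono R ⟨a, t'.1.src, n⟩ * gen lt T c t' ∈
      pathSpan R {q | lt q ⟨t.1.src, d, t.1.path.comp m⟩} := by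
  have h1 := mul_mono_mem_lower hlt m (tail_mem_lt c t)
  have h2 := mono_mul_mem_lower hlt n (tail_mem_lt c t')
  rw [← h] at h2
  have h3 : mono R t.1 * mono R ⟨t.1.tgt, d, m⟩ = mono R ⟨a, t'.1.src, n⟩ * mono R t'.1 := by
    refine (mono_mul_mono_comp t.1.path m).trans ?_
    rw [h]
    exact (mono_mul_mono_comp n t'.1.path).symm
  convert sub_mem h2 h1 using 1
  rw [gen, gen, sub_mul, mul_sub, h3]
  abel

end Reductions

/-! ### Specialization of coefficients and Buchberger's criterion in families. -/

section BaseChange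

variable {S : Type*} [CommRing S] (φ : R →+* S)

/-- Change of coefficients in the path algebra. -/
def mapCoeff : PathAlgebra R V →+ PathAlgebra S V :=
  Finsupp.mapRange.addMonoidHom (ι := QPath V) φ.toAddMonoidHom

@[simp] theorem coeff_mapCoeff (x : PathAlgebra R V) (p : QPath V) :
    coeff (mapCoeff φ x) p = φ (coeff x p) := rfl

theorem mapCoeff_mono (p : QPath V) : mapCoeff φ (mono R p) = mono S p := by
  classical
  refine ext_coeff fun q => ?_
  rw [coeff_mapCoeff, coeff_mono, coeff_mono]
  split_ifs <;> simp

theorem mapCoeff_smul (k : R) (x : PathAlgebra R V) :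
    mapCoeff φ (k • x) = φ k • mapCoeff φ x :=
  ext_coeff fun q => by simp

theorem mapCoeff_mem_pathSpan {W : Set (QPath V)} {x : PathAlgebra R V}
    (hx : x ∈ pathSpan R W) : mapCoeff φ x ∈ pathSpan S W :=
  mem_pathSpan.2 fun p hp => mem_pathSpan.1 hx p fun h => hp (by simp [h])

section Generators

variable {lt : QPath V → QPath V → Prop} {T : Set (QPath V)} (c : Coord lt T → R)
  [Finite (normalPaths T)]

theorem mapCoeff_gen (t : T) : mapCoeff φ (gen lt T c t) = gen lt T (φ ∘ c) t := by
  have h := (mapCoeff φ).map_finsum (f := fun n : normalPathsBelow lt T t => c ⟨t, n⟩ • mono R n.1)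
    (Set.toFinite _)
  simp only [mapCoeff_smul, mapCoeff_mono] at h
  rw [gen, map_sub, mapCoeff_mono]
  exact congrArg (mono S t.1 - ·) h

end Generators

variable [Fintype V]

theorem mapCoeff_mul (x y : PathAlgebra R V) :
    mapCoeff φ (x * y) = mapCoeff φ x * mapCoeff φ y := by
  have hx := mem_pathSpan_univ x
  induction hx using Submodule.span_induction with
  | mem x hx =>
    obtain ⟨⟨a, b, p⟩, -, rfl⟩ := hx
    have hy := mem_pathSpan_univ y
    induction hy using Submodule.span_induction with
    | mem y hy =>
      obtain ⟨⟨b', d, q⟩, -, rfl⟩ := hy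
      rw [mapCoeff_mono, mapCoeff_mono]
      by_cases h : b = b'
      · subst h
        rw [mono_mul_mono_comp, mono_mul_mono_comp, mapCoeff_mono]
      · rw [mono_mul_mono_of_ne h, mono_mul_mono_of_ne h, map_zero]
    | zero => simp
    | add y z _ _ hy hz => rw [mul_add, map_add, map_add, mul_add, hy, hz]
    | smul k y _ hy => rw [mul_smul_comm, mapCoeff_smul, mapCoeff_smul, hy, mul_smul_comm]
  | zero => simp
  | add x z _ _ hx hz => rw [add_mul, map_add, map_add, add_mul, hx, hz]
  | smul k x _ hx => rw [smul_mul_assoc, mapCoeff_smul, mapCoeff_smul, hx, smul_mul_assoc]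

variable {lt : QPath V → QPath V → Prop} {T : Set (QPath V)} {c : Coord lt T → R}
  [Finite (normalPaths T)]

theorem mapCoeff_mem_relSpan {W : Set (QPath V)} {x : PathAlgebra R V}
    (hx : x ∈ relSpan lt T c W) : mapCoeff φ x ∈ relSpan lt T (φ ∘ c) W := by
  induction hx using Submodule.span_induction with
  | mem x hx =>
    obtain ⟨t, a, b, r, s, h, rfl⟩ := hx
    rw [mapCoeff_mul, mapCoeff_mul, mapCoeff_mono, mapCoeff_mono, mapCoeff_gen]
    exact sandwich_mem_relSpan _ t r s h
  | zero => rw [map_zero]; exact zero_mem _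
  | add x y _ _ hx hy => rw [map_add]; exact add_mem hx hy
  | smul k x _ hx => rw [mapCoeff_smul]; exact Submodule.smul_mem _ _ hx

theorem mapCoeff_mem_idealOfPoint {x : PathAlgebra R V} (hx : x ∈ idealOfPoint lt T c) :
    mapCoeff φ x ∈ idealOfPoint lt T (φ ∘ c) :=
  (mem_idealOfPoint_iff _).2 (mapCoeff_mem_relSpan φ ((mem_idealOfPoint_iff c).1 hx))

variable (lt T) in
/-- The ideal of the point `c` contains no nonzero combination of normal paths. -/
def NormalPartTrivial (c : Coord lt T → R) : Prop :=
  ∀ x ∈ idealOfPoint lt T c, x ∈ pathSpan R (normalPaths T) → x = 0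

variable [Nontrivial R]

omit [Finite (normalPaths T)] in
theorem sub_mem_idealOfPoint_of_completeReduction (hlt : IsAdmissibleOrder lt)
    {x y : PathAlgebra R V} (h : CompleteReduction lt (genSet lt T c) x y) :
    x - y ∈ idealOfPoint lt T c :=
  (mem_idealOfPoint_iff c).2 (sub_mem_relSpan_of_reflTransGen hlt (fun _ _ _ _ => trivial)
    (mem_pathSpan_univ x) h.1)

/-- Complete reductions detect membership in the ideal of a point after change of coefficients. -/
theorem mapCoeff_mem_idealOfPoint_iff (hlt : IsAdmissibleOrder lt)
    (hN : NormalPartTrivial lt T (φ ∘ c)) {x y : PathAlgebra R V}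
    (h : CompleteReduction lt (genSet lt T c) x y) :
    mapCoeff φ x ∈ idealOfPoint lt T (φ ∘ c) ↔ mapCoeff φ y = 0 := by
  have h1 := mapCoeff_mem_idealOfPoint φ (sub_mem_idealOfPoint_of_completeReduction hlt h)
  rw [map_sub] at h1
  constructor
  · intro hx
    refine hN _ ?_ (mapCoeff_mem_pathSpan φ ((completeReduction_iff hlt).1 h).2)
    have := TwoSidedIdeal.sub_mem _ hx h1
    rwa [sub_sub_cancel] at this
  · intro hy
    rwa [hy, sub_zero] at h1

/-- Buchberger's criterion for a family of points: the ideal of the point `φ ∘ c` contains no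
nonzero combination of normal paths if and only if the complete reductions of the overlap relations
of the generic elements vanish after change of coefficients. -/
theorem normalPartTrivial_iff [Nontrivial S] (hlt : IsAdmissibleOrder lt) (hT : TipReduced T)
    (ρ : PathAlgebra R V → PathAlgebra R V)
    (hρ : ∀ o, (∃ h ∈ genSet lt T c, ∃ h' ∈ genSet lt T c, IsOverlapRelation lt h h' o) →
      CompleteReduction lt (genSet lt T c) o (ρ o)) :
    NormalPartTrivial lt T (φ ∘ c) ↔
      ∀ o, (∃ h ∈ genSet lt T c, ∃ h' ∈ genSet lt T c, IsOverlapRelation lt h h' o) →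
        mapCoeff φ (ρ o) = 0 := by
  constructor
  · rintro hN o ho
    refine (mapCoeff_mem_idealOfPoint_iff φ hlt hN (hρ o ho)).1 (mapCoeff_mem_idealOfPoint φ ?_)
    obtain ⟨_, ⟨t, rfl⟩, _, ⟨t', rfl⟩, ho⟩ := ho
    obtain ⟨a, d, m, n, -, -, -, -, rfl⟩ := (isOverlapRelation_gen_iff hlt t t').1 ho
    exact TwoSidedIdeal.sub_mem _ (TwoSidedIdeal.mul_mem_right _ _ _ (gen_mem_idealOfPoint c t))
      (TwoSidedIdeal.mul_mem_left _ _ _ (gen_mem_idealOfPoint c t'))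
  · intro h x hx hxN
    refine eq_zero_of_mem_idealOfPoint hlt hT ?_ hx hxN
    intro t t' a d m n h1 h2 h3 h4
    have ho : ∃ h ∈ genSet lt T c, ∃ h' ∈ genSet lt T c, IsOverlapRelation lt h h' _ :=
      ⟨_, ⟨t, rfl⟩, _, ⟨t', rfl⟩,
        (isOverlapRelation_gen_iff hlt t t').2 ⟨a, d, m, n, h1, h2, h3, h4, rfl⟩⟩
    -- The difference between the overlap relation and its remainder is a combination bounded by the
    -- overlap path. Specialization keeps the bound and kills the remainder, so the overlap resolves
    -- at the point.
    have h5 := mapCoeff_mem_relSpan φ (sub_mem_relSpan_of_reflTransGen hlt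
      (fun p hp q hq => hlt.trans hq hp) (overlap_mem_lower hlt t t' h1) (hρ _ ho).1)
    rw [map_sub, h _ ho, sub_zero, map_sub, mapCoeff_mul, mapCoeff_mul, mapCoeff_gen,
      mapCoeff_gen, mapCoeff_mono, mapCoeff_mono] at h5
    exact h5

end BaseChange

end PathAlgebra

/-! ### Tips, normal forms and reduced Gröbner bases over a field. -/

namespace PathAlgebra

variable {K : Type*} [Field K] {V : Type u} [Quiver.{w + 1} V] {lt : QPath V → QPath V → Prop}

open Quiver

theorem _root_.IsTip.sub_mem {x : PathAlgebra K V} {p : QPath V} (h : IsTip lt x p) :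
    x - coeff x p • mono K p ∈ pathSpan K {q | lt q p} := by
  refine mem_pathSpan.2 fun r hr => ?_
  by_cases hrp : p = r
  · subst hrp
    simp at hr
  · rw [coeff_sub, coeff_smul, coeff_mono_of_ne hrp, mul_zero, sub_zero] at hr
    exact (h.2 r hr).resolve_left (Ne.symm hrp)

theorem isTip_of_sub_smul_mem (hlt : IsAdmissibleOrder lt) {x : PathAlgebra K V} {p : QPath V}
    {α : K} (hα : α ≠ 0) (h : x - α • mono K p ∈ pathSpan K {q | lt q p}) : IsTip lt x p := by
  constructor
  · intro h0
    refine hlt.irrefl p (mem_pathSpan.1 h p ?_)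
    rw [coeff_sub, coeff_smul, coeff_mono_self, h0, mul_one, zero_sub]
    exact neg_ne_zero.2 hα
  · intro q hq
    by_cases hqp : p = q
    · exact .inl hqp.symm
    · refine .inr (mem_pathSpan.1 h q ?_)
      rwa [coeff_sub, coeff_smul, coeff_mono_of_ne hqp, mul_zero, sub_zero]

variable [Fintype V] {T : Set (QPath V)}

theorem mem_tipSet_of_isSubpath (hlt : IsAdmissibleOrder lt)
    {I : TwoSidedIdeal (PathAlgebra K V)} {p q : QPath V}
    (hp : p ∈ tipSet lt (I : Set (PathAlgebra K V))) (h : p.IsSubpath q) :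
    q ∈ tipSet lt (I : Set (PathAlgebra K V)) := by
  obtain ⟨x, hx, hp⟩ := hp
  obtain ⟨c, d, p⟩ := p
  obtain ⟨a, b, r, s, rfl⟩ := h
  refine ⟨mono K ⟨a, c, r⟩ * x * mono K ⟨d, b, s⟩, I.mul_mem_right _ _ (I.mul_mem_left _ _ hx),
    isTip_of_sub_smul_mem hlt hp.1 ?_⟩
  have := mul_mono_mem_lower hlt s (mono_mul_mem_lower hlt r hp.sub_mem)
  rw [mul_sub, sub_mul, mul_smul_comm, smul_mul_assoc, mono_mul_mono_comp,
    mono_mul_mono_comp] at this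
  exact this

theorem eq_zero_of_mem_of_mem_nontips (hlt : IsAdmissibleOrder lt)
    {I : TwoSidedIdeal (PathAlgebra K V)} {x : PathAlgebra K V} (hx : x ∈ I)
    (h : x ∈ pathSpan K (nontips lt I)) : x = 0 := by
  by_contra h0
  obtain ⟨p, hp⟩ := exists_isTip hlt h0
  exact mem_pathSpan.1 h p hp.1 ⟨x, hx, hp⟩

/-- Every tip of an ideal is congruent to a combination of smaller nontips. -/
theorem mono_mem_sup_of_mem_tipSet (hlt : IsAdmissibleOrder lt)
    {I : TwoSidedIdeal (PathAlgebra K V)} {p : QPath V}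
    (hp : p ∈ tipSet lt (I : Set (PathAlgebra K V))) :
    mono K p ∈ pathSpan K (nontips lt I ∩ {q | lt q p}) ⊔ I.toPathSubmodule := by
  induction p using hlt.wf.induction with
  | _ p ih =>
  have hlow : pathSpan K {q | lt q p} ≤
      pathSpan K (nontips lt I ∩ {q | lt q p}) ⊔ I.toPathSubmodule := by
    refine Submodule.span_le.2 ?_
    rintro _ ⟨q, hq, rfl⟩
    by_cases hq' : q ∈ tipSet lt (I : Set (PathAlgebra K V))
    · have hle : nontips lt I ∩ {r | lt r q} ⊆ nontips lt I ∩ {r | lt r p} :=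
        fun r hr => ⟨hr.1, hlt.trans hr.2 hq⟩
      exact (sup_le_sup_right (pathSpan_mono hle) I.toPathSubmodule : _ ≤ _) (ih q hq hq')
    · exact Submodule.mem_sup_left (mono_mem_pathSpan ⟨hq', hq⟩)
  obtain ⟨x, hx, hxp⟩ := hp
  have h1 := sub_mem (Submodule.mem_sup_right (show x ∈ I.toPathSubmodule from hx))
    (hlow hxp.sub_mem)
  rw [sub_sub_cancel] at h1
  have := Submodule.smul_mem _ (coeff x p)⁻¹ h1
  rwa [smul_smul, inv_mul_cancel₀ hxp.1, one_smul] at this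

/-- The nontips of an ideal span a complement. -/
theorem pathSpan_nontips_sup_eq_top (hlt : IsAdmissibleOrder lt)
    (I : TwoSidedIdeal (PathAlgebra K V)) :
    pathSpan K (nontips lt I) ⊔ I.toPathSubmodule = ⊤ := by
  rw [eq_top_iff]
  intro x _
  refine Submodule.span_le.2 ?_ (mem_pathSpan_univ x)
  rintro _ ⟨p, -, rfl⟩
  by_cases hp : p ∈ tipSet lt (I : Set (PathAlgebra K V))
  · exact (sup_le_sup_right (pathSpan_mono Set.inter_subset_left) I.toPathSubmodule : _ ≤ _)
      (mono_mem_sup_of_mem_tipSet hlt hp)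
  · exact Submodule.mem_sup_left (mono_mem_pathSpan hp)

/-- The generating set of paths hidden in the definition is the tip set of `G`. A path divisible by
one of its elements is a tip of `I`, and the converse holds because membership of a path in a
monomial ideal is divisibility. -/
theorem _root_.IsReducedGroebnerBasis.nontips_eq (hlt : IsAdmissibleOrder lt)
    {G : Set (PathAlgebra K V)} {I : TwoSidedIdeal (PathAlgebra K V)}
    (h : IsReducedGroebnerBasis lt G I) : nontips lt I = normalPaths (tipSet lt G) := by
  obtain ⟨T, hT, rfl⟩ := h
  have hmem : ∀ p, p ∈ tipSet lt (I : Set (PathAlgebra K V)) ↔ ∃ t ∈ T, t.IsSubpath p := by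
    intro p
    rw [← mono_mem_pathIdeal (R := K), hT.prop, mono_mem_pathIdeal]
    constructor
    · exact fun hp => ⟨p, hp, .refl p⟩
    · rintro ⟨q, hq, hqp⟩
      exact mem_tipSet_of_isSubpath hlt hq hqp
  have htip : tipSet lt {g | g ∈ I ∧
      ∃ t ∈ T, mono K t - g ∈ Submodule.span K (mono K '' nontips lt I)} = T := by
    ext p
    constructor
    · rintro ⟨g, ⟨hg, t, ht, hgt⟩, hgp⟩
      by_cases htp : t = p
      · exact htp ▸ ht
      -- If `p ≠ t`, the tip `p` of `g` would occur in `t - g`, a combination of nontips.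
      · refine (mem_pathSpan.1 hgt p ?_ ⟨g, hg, hgp⟩).elim
        rw [coeff_sub, coeff_mono_of_ne htp, zero_sub]
        exact neg_ne_zero.2 hgp.1
    · intro hp
      obtain ⟨y, hy, g, hg, hyg⟩ := Submodule.mem_sup.1
        (mono_mem_sup_of_mem_tipSet hlt ((hmem p).2 ⟨p, hp, .refl p⟩))
      refine ⟨g, ⟨hg, p, hp, ?_⟩, isTip_of_sub_smul_mem hlt one_ne_zero ?_⟩
      · rw [← hyg, add_sub_cancel_right]
        exact pathSpan_mono Set.inter_subset_left hy
      · rw [← hyg, one_smul, sub_add_cancel_right]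
        exact neg_mem (pathSpan_mono Set.inter_subset_right hy)
  rw [htip]
  ext p
  rw [← not_iff_not, mem_normalPaths_iff, ← hmem]
  exact not_not

omit [Fintype V] in
theorem tipSet_genSet (hlt : IsAdmissibleOrder lt) (c : Coord lt T → K) :
    tipSet lt (genSet lt T c) = T := by
  ext p
  constructor
  · rintro ⟨_, ⟨t, rfl⟩, hp⟩
    exact hp.unique hlt (isTip_gen c t hlt) ▸ t.2
  · exact fun hp => ⟨_, ⟨⟨p, hp⟩, rfl⟩, isTip_gen c ⟨p, hp⟩ hlt⟩

theorem nontips_idealOfPoint_subset (hlt : IsAdmissibleOrder lt) (c : Coord lt T → K) :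
    nontips lt (idealOfPoint lt T c) ⊆ normalPaths T := by
  intro p hp t ht h
  exact hp (mem_tipSet_of_isSubpath hlt
    ⟨_, gen_mem_idealOfPoint c ⟨t, ht⟩, isTip_gen c ⟨t, ht⟩ hlt⟩ h)

/-- A normal path that is a tip would be congruent to a combination of smaller nontips, which are
normal too. By independence it would equal that combination. -/
theorem NormalPartTrivial.nontips_eq (hlt : IsAdmissibleOrder lt) {c : Coord lt T → K}
    (h : NormalPartTrivial lt T c) : nontips lt (idealOfPoint lt T c) = normalPaths T := by
  refine (nontips_idealOfPoint_subset hlt c).antisymm fun p hp hp' => ?_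
  obtain ⟨y, hy, g, hg, hyg⟩ := Submodule.mem_sup.1 (mono_mem_sup_of_mem_tipSet hlt hp')
  have hg' : g = mono K p - y := by rw [← hyg, add_sub_cancel_left]
  have h0 : g = 0 := h g hg (hg' ▸ sub_mem (mono_mem_pathSpan hp)
    (pathSpan_mono (fun q hq => nontips_idealOfPoint_subset hlt c hq.1) hy))
  rw [h0, add_zero] at hyg
  exact hlt.irrefl p (mem_pathSpan.1 hy p (by rw [hyg]; simp)).2

/-- The points of `V_T` are the points whose ideal contains no nonzero combination of normal
paths. -/
theorem mem_varietyOfTips_iff (hlt : IsAdmissibleOrder lt) (hT : TipReduced T)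
    {c : Coord lt T → K} : c ∈ varietyOfTips K lt T ↔ NormalPartTrivial lt T c := by
  constructor
  · intro h x hx hN
    have h1 := IsReducedGroebnerBasis.nontips_eq hlt h
    rw [tipSet_genSet hlt c] at h1
    exact eq_zero_of_mem_of_mem_nontips hlt hx (h1 ▸ hN)
  · intro h
    have hmem : ∀ p, p ∈ tipSet lt (idealOfPoint lt T c : Set (PathAlgebra K V)) ↔
        ∃ t ∈ T, t.IsSubpath p := fun p => by
      rw [← mem_normalPaths_iff, ← h.nontips_eq hlt]
      exact not_not.symm
    refine ⟨T, ⟨?_, ?_⟩, ?_⟩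
    · refine le_antisymm (TwoSidedIdeal.span_le.2 ?_) (TwoSidedIdeal.span_le.2 ?_)
      · rintro _ ⟨t, ht, rfl⟩
        exact mono_mem_pathIdeal.2 ⟨t, (hmem t).2 ⟨t, ht, .refl t⟩, .refl t⟩
      · rintro _ ⟨t, ht, rfl⟩
        exact mono_mem_pathIdeal.2 ((hmem t).1 ht)
    -- Minimality: a generating subset of `T` contains a subpath of `t`, which is `t` itself as `T`
    -- is tip-reduced.
    · intro S hS hST t ht
      have h1 : mono K t ∈ pathIdeal K S := by
        rw [hS]
        exact mono_mem_pathIdeal.2 ⟨t, (hmem t).2 ⟨t, ht, .refl t⟩, .refl t⟩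
      obtain ⟨s, hs, hst⟩ := mono_mem_pathIdeal.1 h1
      by_contra hne
      exact hT s (hST hs) t ht (fun e => hne (e ▸ hs)) hst
    · rw [h.nontips_eq hlt]
      ext g
      constructor
      · rintro ⟨t, rfl⟩
        refine ⟨gen_mem_idealOfPoint c t, t.1, t.2, ?_⟩
        rw [sub_sub_cancel]
        exact tail_mem_normal c t
      · rintro ⟨hg, t, ht, hgt⟩
        refine ⟨⟨t, ht⟩, ?_⟩
        refine sub_eq_zero.1 (h (gen lt T c ⟨t, ht⟩ - g)
          (TwoSidedIdeal.sub_mem _ (gen_mem_idealOfPoint c _) hg) ?_)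
        have := sub_mem hgt (tail_mem_normal c ⟨t, ht⟩)
        rwa [sub_right_comm] at this

theorem pathSpan_normalPaths_sup_eq_top (hlt : IsAdmissibleOrder lt) (c : Coord lt T → K) :
    pathSpan K (normalPaths T) ⊔ (idealOfPoint lt T c).toPathSubmodule = ⊤ :=
  eq_top_iff.2 ((pathSpan_nontips_sup_eq_top hlt (idealOfPoint lt T c)).ge.trans
    (sup_le_sup_right (pathSpan_mono (nontips_idealOfPoint_subset hlt c)) _))

/-- An ideal that contains the elements `g_t` of a point and no nonzero combination of normal paths
is the ideal of that point. -/
theorem eq_idealOfPoint (hlt : IsAdmissibleOrder lt) {c : Coord lt T → K}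
    {I : TwoSidedIdeal (PathAlgebra K V)} (hI : ∀ t, gen lt T c t ∈ I)
    (h : ∀ x ∈ I, x ∈ pathSpan K (normalPaths T) → x = 0) : idealOfPoint lt T c = I := by
  have hle : idealOfPoint lt T c ≤ I := TwoSidedIdeal.span_le.2 (by rintro _ ⟨t, rfl⟩; exact hI t)
  refine le_antisymm hle fun x hx => ?_
  obtain ⟨y, hy, g, hg, rfl⟩ := Submodule.mem_sup.1
    ((pathSpan_normalPaths_sup_eq_top hlt c).ge (Submodule.mem_top (x := x)))
  have : y = 0 := h y (by simpa using I.sub_mem hx (hle hg)) hy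
  rw [this, zero_add]
  exact hg

/-- An ideal with nontips `normalPaths T` is the ideal of a point. -/
theorem exists_idealOfPoint_eq [Finite (normalPaths T)] (hlt : IsAdmissibleOrder lt)
    {I : TwoSidedIdeal (PathAlgebra K V)} (hI : nontips lt I = normalPaths T) :
    ∃ c : Coord lt T → K, idealOfPoint lt T c = I := by
  have hex : ∀ t : T, ∃ y ∈ pathSpan K (normalPaths T ∩ {q | lt q t.1}), mono K t.1 - y ∈ I := by
    intro t
    have ht : t.1 ∈ tipSet lt (I : Set (PathAlgebra K V)) := by
      by_contra h
      exact (hI ▸ h : t.1 ∈ normalPaths T) t.1 t.2 (.refl _)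
    obtain ⟨y, hy, g, hg, hyg⟩ := Submodule.mem_sup.1 (mono_mem_sup_of_mem_tipSet hlt ht)
    refine ⟨y, hI ▸ hy, ?_⟩
    rw [← hyg, add_sub_cancel_left]
    exact hg
  choose y hy hyI using hex
  refine ⟨fun i => coeff (y i.1) i.2.1, eq_idealOfPoint hlt (fun t => ?_) fun x hx hN =>
    eq_zero_of_mem_of_mem_nontips hlt hx (hI ▸ hN)⟩
  set c : Coord lt T → K := fun i => coeff (y i.1) i.2.1
  -- The normal form `y t` might contain paths not parallel to `t`, which no coordinate records. On
  -- parallel paths it agrees with the tail, and multiplying by the end vertices of `t` removes the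
  -- rest.
  have hz : mono K ⟨t.1.src, t.1.src, Path.nil⟩ * (y t - tail lt T c t) *
      mono K ⟨t.1.tgt, t.1.tgt, Path.nil⟩ = 0 := by
    have h1 : y t - tail lt T c t ∈ pathSpan K {q | ¬ q.Parallel t.1} := by
      refine mem_pathSpan.2 fun q hq hpar => hq ?_
      rw [coeff_sub, sub_eq_zero]
      by_cases hq0 : q ∈ normalPathsBelow lt T t
      · exact (coeff_tail c t ⟨q, hq0⟩).symm
      · have h2 : coeff (tail lt T c t) q = 0 := by
          by_contra h
          exact hq0 (mem_pathSpan.1 (tail_mem c t) q h)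
        rw [h2]
        by_contra h
        have h3 := mem_pathSpan.1 (hy t) q h
        exact hq0 ⟨h3.1, hpar, h3.2⟩
    have h2 := mul_mono_mem_pathSpan (S' := ∅) (Path.nil : Path t.1.tgt t.1.tgt) ?_
      (mono_mul_mem_pathSpan (S' := {q | q.src = t.1.src ∧ ¬ q.Parallel t.1})
        (Path.nil : Path t.1.src t.1.src) ?_ h1)
    · exact ext_coeff fun p => by
        by_contra h
        exact mem_pathSpan.1 h2 p h
    · rintro a q ⟨h3, h4⟩
      exact h4 ⟨h3, rfl⟩
    · intro d q hq
      rw [Path.nil_comp]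
      exact ⟨rfl, hq⟩
  have h1 := I.mul_mem_right _ (mono K ⟨t.1.tgt, t.1.tgt, Path.nil⟩)
    (I.mul_mem_left (mono K ⟨t.1.src, t.1.src, Path.nil⟩) _ (hyI t))
  have h2 : mono K t.1 - y t = gen lt T c t - (y t - tail lt T c t) := by
    rw [gen]; abel
  rw [h2, mul_sub, sub_mul, hz, sub_zero, mono_vertex_mul_gen_mul] at h1
  exact h1

/-- Both tails are normal and congruent to `t` modulo the same ideal, so their difference vanishes.
-/
theorem idealOfPoint_injOn [Finite (normalPaths T)] {c c' : Coord lt T → K}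
    (h : NormalPartTrivial lt T c) (hcc : idealOfPoint lt T c = idealOfPoint lt T c') :
    c = c' := by
  funext ⟨t, n⟩
  have h0 : tail lt T c' t - tail lt T c t = 0 := by
    refine h _ ?_ (sub_mem (tail_mem_normal c' t) (tail_mem_normal c t))
    have := TwoSidedIdeal.sub_mem _ (gen_mem_idealOfPoint c t)
      (hcc ▸ gen_mem_idealOfPoint c' t)
    rwa [gen, gen, sub_sub_sub_cancel_left] at this
  rw [← coeff_tail c t n, ← coeff_tail c' t n, sub_eq_zero.1 h0]

/-- The quotient of the path algebra by an ideal that contains a power of the arrow ideal is finite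
dimensional. -/
theorem finiteDimensional_quotient [∀ a b : V, Finite (a ⟶ b)]
    {I : TwoSidedIdeal (PathAlgebra K V)} {m : ℕ}
    (h : (arrowIdeal K V).asIdeal ^ m ≤ I.asIdeal) :
    FiniteDimensional K I.ringCon.Quotient := by
  let π : PathAlgebra K V →ₗ[K] I.ringCon.Quotient :=
    { toFun := fun x => (x : I.ringCon.Quotient)
      map_add' := fun _ _ => rfl
      map_smul' := fun _ _ => rfl }
  have hπ : Function.Surjective π := Quotient.mk_surjective
  have hfin : (pathSpan K {p : QPath V | p.length < m}).FG :=
    Submodule.fg_span ((QPath.finite_length_lt m).image _)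
  suffices htop : (pathSpan K {p : QPath V | p.length < m}).map π = ⊤ from
    ⟨htop ▸ hfin.map π⟩
  rw [eq_top_iff, ← LinearMap.range_eq_top.2 hπ]
  rintro _ ⟨x, rfl⟩
  have hx := mem_pathSpan_univ x
  induction hx using Submodule.span_induction with
  | mem x hx =>
    obtain ⟨p, -, rfl⟩ := hx
    rcases lt_or_ge p.length m with hp | hp
    · exact ⟨_, mono_mem_pathSpan hp, rfl⟩
    · have : π (mono K p) = 0 :=
        (RingCon.eq _).2 ((I.mem_iff _).1
          (TwoSidedIdeal.mem_asIdeal.1 (h (mono_mem_arrowIdeal_pow m p hp))))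
      rw [this]
      exact zero_mem _
  | zero => rw [map_zero]; exact zero_mem _
  | add x y _ _ hx hy => rw [map_add]; exact add_mem hx hy
  | smul k x _ hx => rw [map_smul]; exact Submodule.smul_mem _ _ hx

end PathAlgebra

/-! ### The two varieties and the correspondence with admissible ideals. -/

namespace PathAlgebra

variable {K : Type*} [Field K] {V : Type u} [Quiver.{w + 1} V] [Fintype V]
  {lt : QPath V → QPath V → Prop} {T : Set (QPath V)} {m : ℕ}

open Quiver

theorem length_lt_of_mem_normalPaths (hJ : (arrowIdeal K V).asIdeal ^ m ≤ (pathIdeal K T).asIdeal)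
    {p : QPath V} (hp : p ∈ normalPaths T) : p.length < m := by
  by_contra h
  obtain ⟨t, ht, htp⟩ := mono_mem_pathIdeal.1
    (TwoSidedIdeal.mem_asIdeal.1 (hJ (mono_mem_arrowIdeal_pow m p (not_lt.1 h))))
  exact hp t ht htp

/-- The first `m` arrows of a longer element of `T` would already contain another element of `T`.
This makes `T` finite. -/
theorem length_le_of_tipReduced (hT : TipReduced T)
    (hJ : (arrowIdeal K V).asIdeal ^ m ≤ (pathIdeal K T).asIdeal)
    {p : QPath V} (hp : p ∈ T) : p.length ≤ m := by
  by_contra! h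
  obtain ⟨c, r, s, hrs, hr⟩ := p.path.exists_eq_comp_length_eq m h.le
  obtain ⟨t, ht, htr⟩ := mono_mem_pathIdeal.1
    (arrowIdeal_pow_le_iff.1 hJ ⟨p.src, c, r⟩ hr)
  have hrp : (⟨p.src, c, r⟩ : QPath V).IsSubpath p :=
    ⟨_, _, Path.nil, s, by rw [Path.nil_comp, ← hrs]⟩
  have hl : t.length ≤ r.length := htr.length_le
  have htp : t ≠ p := by
    rintro rfl
    omega
  exact hT t ht p hp htp (htr.trans hrp)

section Finiteness

variable [∀ a b : V, Finite (a ⟶ b)]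

theorem finite_normalPaths (hJ : (arrowIdeal K V).asIdeal ^ m ≤ (pathIdeal K T).asIdeal) :
    Finite (normalPaths T) :=
  (QPath.finite_length_lt m).subset fun _ hp => length_lt_of_mem_normalPaths hJ hp

theorem finite_coord (hT : TipReduced T)
    (hJ : (arrowIdeal K V).asIdeal ^ m ≤ (pathIdeal K T).asIdeal) : Finite (Coord lt T) := by
  have := finite_normalPaths hJ
  have : Finite T := (QPath.finite_length_lt (m + 1)).subset fun _ hp =>
    Nat.lt_succ_of_le (length_le_of_tipReduced hT hJ hp)
  infer_instance

end Finiteness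

variable [Finite (normalPaths T)]

/-- The points of `V_T` form an affine variety. -/
theorem isAffineVariety_varietyOfTips (hlt : IsAdmissibleOrder lt) (hT : TipReduced T)
    [hfin : Finite (Coord lt T)] : IsAffineVariety (varietyOfTips K lt T) := by
  -- All variables are kept here, including those of short paths, since `V_T` puts no condition on
  -- lengths.
  let c : Coord lt T → MvPolynomial (Coord lt T) K := MvPolynomial.X
  choose ρ hρ using fun x : PathAlgebra (MvPolynomial (Coord lt T) K) V =>
    exists_completeReduction (c := c) hlt x
  refine ⟨hfin, Ideal.span {f | ∃ o, (∃ h ∈ genSet lt T c, ∃ h' ∈ genSet lt T c,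
    IsOverlapRelation lt h h' o) ∧ ∃ n, f = coeff (ρ o) n}, ?_⟩
  ext x
  let φ : MvPolynomial (Coord lt T) K →+* K := (MvPolynomial.aeval x).toRingHom
  have hφ : φ ∘ c = x := funext fun i => MvPolynomial.aeval_X x i
  rw [mem_varietyOfTips_iff hlt hT, ← hφ, normalPartTrivial_iff φ hlt hT ρ fun o _ => hρ o, hφ,
    MvPolynomial.zeroLocus_span]
  constructor
  · rintro h _ ⟨o, ho, n, rfl⟩
    exact congrArg (coeff · n) (h o ho)
  · intro h o ho
    exact ext_coeff fun n => by
      rw [coeff_mapCoeff, coeff_zero]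
      exact h _ ⟨o, ho, n, rfl⟩

/-- The points of the variety of admissible ideals. -/
theorem mem_admissibleVariety_iff (hlt : IsAdmissibleOrder lt) (hT : TipReduced T)
    {ρ : PathAlgebra (MvPolynomial (Coord lt T) K) V → PathAlgebra (MvPolynomial (Coord lt T) K) V}
    (hρ : IsReductionChoice K lt T m ρ) {x : Coord lt T → K} :
    x ∈ admissibleVariety K lt T m ρ ↔
      (∀ i : Coord lt T, i.2.1.length < 2 → x i = 0) ∧ NormalPartTrivial lt T x ∧
        (arrowIdeal K V).asIdeal ^ m ≤ (idealOfPoint lt T x).asIdeal := by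
  let c : Coord lt T → MvPolynomial (Coord lt T) K :=
    fun i => if 2 ≤ i.2.1.length then MvPolynomial.X i else 0
  let φ : MvPolynomial (Coord lt T) K →+* K := (MvPolynomial.aeval x).toRingHom
  have hzero : x ∈ admissibleVariety K lt T m ρ ↔
      (∀ i : Coord lt T, i.2.1.length < 2 → x i = 0) ∧
      (∀ o ∈ genericOverlaps K lt T, mapCoeff φ (ρ o) = 0) ∧
      ∀ y ∈ pathsOfLength K lt T m, mapCoeff φ (ρ y) = 0 := by
    have hcoeff : ∀ z : PathAlgebra (MvPolynomial (Coord lt T) K) V,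
        mapCoeff φ z = 0 ↔ ∀ n, MvPolynomial.aeval x (coeff z n) = 0 := fun z =>
      ⟨fun h n => congrArg (coeff · n) h, fun h => ext_coeff fun n => by
        rw [coeff_mapCoeff, coeff_zero]; exact h n⟩
    rw [admissibleVariety, MvPolynomial.zeroLocus_span]
    simp only [hcoeff]
    constructor
    · intro h
      refine ⟨fun i hi => ?_, fun o ho n => h _ (.inl (.inr ⟨o, ho, n, rfl⟩)),
        fun y hy n => h _ (.inr ⟨y, hy, n, rfl⟩)⟩
      have := h _ (.inl (.inl ⟨i, hi, rfl⟩))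
      rwa [MvPolynomial.aeval_X] at this
    · rintro ⟨h1, h2, h3⟩ _ ((⟨i, hi, rfl⟩ | ⟨o, ho, n, rfl⟩) | ⟨y, hy, n, rfl⟩)
      · rw [MvPolynomial.aeval_X]
        exact h1 i hi
      · exact h2 o ho n
      · exact h3 y hy n
  rw [hzero]
  refine and_congr_right fun hshort => ?_
  -- The generic elements omit the short variables, so they specialize to the `g_t` of `x` only
  -- because the short coordinates of `x` are already known to vanish.
  have hφ : φ ∘ c = x := funext fun i => by
    by_cases hi : 2 ≤ i.2.1.length
    · simp only [Function.comp, c, if_pos hi]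
      exact MvPolynomial.aeval_X x i
    · simp only [Function.comp, c, if_neg hi, map_zero]
      exact (hshort i (not_le.1 hi)).symm
  have hN := normalPartTrivial_iff (c := c) φ hlt hT ρ fun o ho => hρ o (.inl ho)
  rw [hφ] at hN
  refine (and_congr_left' hN.symm).trans (and_congr_right fun hx => ?_)
  rw [arrowIdeal_pow_le_iff]
  have hp : ∀ p : QPath V, p.length = m →
      (mapCoeff φ (ρ (mono _ p)) = 0 ↔ mono K p ∈ idealOfPoint lt T x) := fun p hp => by
    have := mapCoeff_mem_idealOfPoint_iff (c := c) φ hlt (hφ.symm ▸ hx)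
      (hρ (mono _ p) (.inr ⟨p, hp, rfl⟩))
    rw [hφ, mapCoeff_mono] at this
    exact this.symm
  constructor
  · exact fun h p hpm => (hp p hpm).1 (h _ ⟨p, hpm, rfl⟩)
  · rintro h _ ⟨p, hpm, rfl⟩
    exact (hp p hpm).2 (h p hpm)

/-- As `t` has length at least `2`, the element `g_t` lies in `J^2` exactly when its tail has no
path of length below `2`. -/
theorem idealOfPoint_le_arrowIdeal_sq_iff (hT2 : ∀ t ∈ T, 2 ≤ t.length) {x : Coord lt T → K} :
    (idealOfPoint lt T x).asIdeal ≤ (arrowIdeal K V).asIdeal ^ 2 ↔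
      ∀ i : Coord lt T, i.2.1.length < 2 → x i = 0 := by
  constructor
  · rintro h ⟨t, n⟩ hn
    have h1 := mem_arrowIdeal_pow.1
      (h (TwoSidedIdeal.mem_asIdeal.2 (gen_mem_idealOfPoint x t)))
    have h2 := sub_mem (mono_mem_pathSpan (R := K) (S := {p | 2 ≤ p.length}) (hT2 t.1 t.2)) h1
    rw [gen, sub_sub_cancel] at h2
    rw [← coeff_tail x t n]
    by_contra h0
    exact absurd (mem_pathSpan.1 h2 _ h0) (not_le.2 hn)
  · intro h z hz
    refine mem_arrowIdeal_pow.2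
      (span_subset_of_mono_mul_mem ?_ ?_ ?_ (TwoSidedIdeal.mem_asIdeal.1 hz))
    · rintro _ ⟨t, rfl⟩
      refine sub_mem (mono_mem_pathSpan (hT2 t.1 t.2)) (mem_pathSpan.2 fun p hp => ?_)
      by_contra hp2
      refine hp ?_
      have hpN := mem_pathSpan.1 (tail_mem x t) p hp
      exact (coeff_tail x t ⟨p, hpN⟩).trans (h ⟨t, ⟨p, hpN⟩⟩ (not_le.1 hp2))
    · rintro p y hy
      have hp : mono K p ∈ pathSpan K {p | 0 ≤ p.length} := mono_mem_pathSpan (Nat.zero_le _)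
      simpa only [zero_add] using mul_mem_pathSpan_length hp hy
    · rintro p y hy
      have hp : mono K p ∈ pathSpan K {p | 0 ≤ p.length} := mono_mem_pathSpan (Nat.zero_le _)
      simpa only [add_zero] using mul_mem_pathSpan_length hy hp

/-- The points of the variety of admissible ideals correspond to the admissible ideals. -/
theorem bijOn_idealOfPoint (hlt : IsAdmissibleOrder lt) (hT : TipReduced T)
    (hT2 : ∀ t ∈ T, 2 ≤ t.length)
    {ρ : PathAlgebra (MvPolynomial (Coord lt T) K) V → PathAlgebra (MvPolynomial (Coord lt T) K) V}
    (hρ : IsReductionChoice K lt T m ρ) :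
    Set.BijOn (idealOfPoint lt T) (admissibleVariety K lt T m ρ)
      (admissibleIdeals K lt T m) := by
  refine ⟨fun x hx => ?_, fun x hx x' _ h => ?_, ?_⟩
  · obtain ⟨h1, h2, h3⟩ := (mem_admissibleVariety_iff hlt hT hρ).1 hx
    exact ⟨h3, (idealOfPoint_le_arrowIdeal_sq_iff hT2).2 h1, genSet lt T x,
      (mem_varietyOfTips_iff hlt hT).2 h2, tipSet_genSet hlt x⟩
  · exact idealOfPoint_injOn ((mem_admissibleVariety_iff hlt hT hρ).1 hx).2.1 h
  -- Surjectivity: the tip set `T` fixes the nontips of `I`, so `I` is the ideal of a point, and the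
  -- two inclusions place that point in the variety.
  · rintro I ⟨h1, h2, G, hG, hGT⟩
    have hI := IsReducedGroebnerBasis.nontips_eq hlt hG
    rw [hGT] at hI
    obtain ⟨x, rfl⟩ := exists_idealOfPoint_eq hlt hI
    exact ⟨x, (mem_admissibleVariety_iff hlt hT hρ).2
      ⟨(idealOfPoint_le_arrowIdeal_sq_iff hT2).1 h2, fun z hz hzN =>
        eq_zero_of_mem_of_mem_nontips hlt hz (hI ▸ hzN), h1⟩, rfl⟩

end PathAlgebra

end

theorem mainTheorem5 {K : Type*} [Field K] {V : Type*} [Quiver.{w + 1} V] [Fintype V]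
    [∀ a b : V, Finite (a ⟶ b)]
    (lt : QPath V → QPath V → Prop) (hlt : IsAdmissibleOrder lt)
    (m : ℕ) (hm : 2 ≤ m)
    (T : Set (QPath V)) (hT : TipReduced T) (hT2 : ∀ t ∈ T, 2 ≤ t.length)
    (hJ : (arrowIdeal K V).asIdeal ^ m ≤ (pathIdeal K T).asIdeal) :
    -- complete reductions exist, and the zero set does not depend on the chosen ones
    (∃ ρ, IsReductionChoice K lt T m ρ) ∧
    (∀ ρ ρ', IsReductionChoice K lt T m ρ → IsReductionChoice K lt T m ρ' →
      admissibleVariety K lt T m ρ = admissibleVariety K lt T m ρ') ∧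
    IsAffineVariety (varietyOfTips K lt T) ∧
    (∀ I ∈ admissibleIdeals K lt T m, FiniteDimensional K I.ringCon.Quotient) ∧
    ∀ ρ, IsReductionChoice K lt T m ρ →
      IsAffineVariety (admissibleVariety K lt T m ρ) ∧
      admissibleVariety K lt T m ρ ⊆ varietyOfTips K lt T ∧
      Set.BijOn (idealOfPoint lt T) (admissibleVariety K lt T m ρ) (admissibleIdeals K lt T m) := by
  have hN : Finite (normalPaths T) := PathAlgebra.finite_normalPaths hJ
  have hD : Finite (Coord lt T) := PathAlgebra.finite_coord hT hJ
  refine ⟨?_, fun ρ ρ' hρ hρ' => ?_, PathAlgebra.isAffineVariety_varietyOfTips hlt hT,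
    fun I hI => PathAlgebra.finiteDimensional_quotient hI.1, fun ρ hρ =>
      ⟨⟨hD, _, rfl⟩, fun x hx => ?_, PathAlgebra.bijOn_idealOfPoint hlt hT hT2 hρ⟩⟩
  · choose ρ hρ using fun x : PathAlgebra (MvPolynomial (Coord lt T) K) V =>
      PathAlgebra.exists_completeReduction
        (c := fun i : Coord lt T => if 2 ≤ i.2.1.length then MvPolynomial.X i else 0) hlt x
    exact ⟨ρ, fun x _ => hρ x⟩
  -- Both zero sets have the same description free of `ρ`.
  · ext x
    rw [PathAlgebra.mem_admissibleVariety_iff hlt hT hρ,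
      PathAlgebra.mem_admissibleVariety_iff hlt hT hρ']
  · exact (PathAlgebra.mem_varietyOfTips_iff hlt hT).2
      ((PathAlgebra.mem_admissibleVariety_iff hlt hT hρ).1 hx).2.1
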